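/- Let $\alpha,\beta\in(0,1)$ with $\alpha+\beta<1$, and let $\Lambda=\{\lambda_k\}_{k\ge1}$ be a nondecreasing sequence of positive numbers such that the sequence $\lambda_k/k^{1-(\alpha+\beta)}$ is nonincreasing and tends to $0$, and $$\sum_{k=1}^\infty \frac{\lambda_k}{k^{2-(\alpha+\beta)}}=\infty .$$ Let $P\Lambda BV$ be the class of functions $f:\mathbb R^2\to\mathbb R$, $2\pi$-periodic in each variable, with $$\sup_{y\in[0,2\pi]}\sup_{\{I_i\}}\sum_i\frac{|f(b_i,y)-f(a_i,y)|}{\lambda_i}+\sup_{x\in[0,2\pi]}\sup_{\{I_i\}}\sum_i\frac{|f(x,b_i)-f(x,a_i)|}{\lambda_i}<\infty ,$$ where $\{I_i\}=\{(a_i,b_i)\}_{i=1,2,\dots}$ runs over all collections of nonoverlapping intervals in $[0,2\pi]$, numbered in arbitrary order. For such $f$, integrable on $[0,2\pi]^2$, put $$\widehat f(m,n)=\frac1{4\pi^2}\int_0^{2\pi}\!\!\int_0^{2\pi} f(x,y)e^{-imx}e^{-iny}\,dx\,dy,\qquad S_{M,N}[f,(x,y)]=\sum_{m=-M}^{M}\sum_{n=-N}^{N}\widehat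 f(m,n)e^{imx}e^{iny},$$ and for $a,b>-1$ let the Ces\`aro $(C;a,b)$ means be $$\sigma^{a,b}_{n,m}f(x,y)=\frac1{A_n^{a}A_m^{b}}\sum_{i=0}^n\sum_{j=0}^m A_{n-i}^{a-1}A_{m-j}^{b-1}S_{i,j}[f,(x,y)],\qquad A_0^{a}=1,\quad A_k^{a}=\frac{(a+1)\cdots(a+k)}{k!}.$$ Then there exists a continuous function $f\in P\Lambda BV$ whose $(C;-\alpha,-\beta)$ means diverge over cubes at $(0,0)$, and even $$\sup_{N}\bigl|\sigma^{-\alpha,-\beta}_{N,N}f(0,0)\bigr|=\infty ;$$ that is, the sequence $\sigma^{-\alpha,-\beta}_{N,N}f(0,0)$ is unbounded and, in particular, has no limit as $N\to\infty$. -/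

import Mathlib

open scoped ENNReal

noncomputable section

namespace DoubleFourier

/-- A finite collection of nonoverlapping intervals `(left i, right i)` of `[0, 2π]`, listed in an
arbitrary order. (An infinite sequence of such intervals contributes the supremum of the
contributions of its finite initial segments, so finite collections give the same suprema.) -/
structure IntervalFamily where
  card : ℕ
  left : Fin card → ℝ
  right : Fin card → ℝ
  left_nonneg : ∀ i, 0 ≤ left i
  left_lt_right : ∀ i, left i < right i
  right_le : ∀ i, right i ≤ 2 * Real.pi
  nonoverlapping : ∀ i j, i ≠ j →
    Disjoint (Set.Ioo (left i) (right i)) (Set.Ioo (left j) (right j))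

/-- `∑ᵢ |g(Iᵢ)| / λᵢ` for `E = {Iᵢ}`, where `g((a, b)) = g b - g a` and numbering starts at `1`. -/
def IntervalFamily.weightedSum (E : IntervalFamily) (lam : ℕ → ℝ) (g : ℝ → ℝ) : ℝ :=
  ∑ i : Fin E.card, |g (E.right i) - g (E.left i)| / lam (i.val + 1)

/-- The partial `Λ`-variation in the first variable. -/
def lambdaVar₁ (lam : ℕ → ℝ) (f : ℝ → ℝ → ℝ) : ℝ≥0∞ :=
  ⨆ y ∈ Set.Icc 0 (2 * Real.pi), ⨆ E : IntervalFamily,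
    ENNReal.ofReal (E.weightedSum lam (fun x => f x y))

/-- The partial `Λ`-variation in the second variable. -/
def lambdaVar₂ (lam : ℕ → ℝ) (f : ℝ → ℝ → ℝ) : ℝ≥0∞ :=
  ⨆ x ∈ Set.Icc 0 (2 * Real.pi), ⨆ F : IntervalFamily,
    ENNReal.ofReal (F.weightedSum lam (fun y => f x y))

/-- The class `PΛBV`: functions of period `2π` in each variable of bounded partial
`Λ`-variation. -/
structure IsPLambdaBV (lam : ℕ → ℝ) (f : ℝ → ℝ → ℝ) : Prop where
  periodic₁ : ∀ x y, f (x + 2 * Real.pi) y = f x y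
  periodic₂ : ∀ x y, f x (y + 2 * Real.pi) = f x y
  variation_lt_top : lambdaVar₁ lam f + lambdaVar₂ lam f < ⊤

/-- The Fourier coefficient `(1 / 4π²) ∫₀^{2π} ∫₀^{2π} f(x,y) e^{-imx} e^{-iny} dx dy`. -/
def fourierCoeff₂ (f : ℝ → ℝ → ℝ) (m n : ℤ) : ℂ :=
  1 / (4 * (Real.pi : ℂ) ^ 2) *
    ∫ y in (0 : ℝ)..(2 * Real.pi), ∫ x in (0 : ℝ)..(2 * Real.pi),
      (f x y : ℂ) * Complex.exp (-(Complex.I * m * x)) * Complex.exp (-(Complex.I * n * y))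

/-- The rectangular partial sum `S_{M,N}[f, (x, y)]`. -/
def partialSum (f : ℝ → ℝ → ℝ) (M N : ℕ) (x y : ℝ) : ℂ :=
  ∑ m ∈ Finset.Icc (-(M : ℤ)) (M : ℤ), ∑ n ∈ Finset.Icc (-(N : ℤ)) (N : ℤ),
    fourierCoeff₂ f m n * Complex.exp (Complex.I * m * x) * Complex.exp (Complex.I * n * y)

/-- `A_k^α = (α + 1) ⋯ (α + k) / k!`, with `A_0^α = 1`. -/
def cesaroNumber (α : ℝ) (k : ℕ) : ℝ :=
  (∏ i ∈ Finset.Icc 1 k, (α + (i : ℝ))) / (k.factorial : ℝ)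

/-- The Cesàro `(C; α, β)` mean `σ_{n,m}^{α,β} f(x, y)`. -/
def cesaroMean (α β : ℝ) (f : ℝ → ℝ → ℝ) (n m : ℕ) (x y : ℝ) : ℂ :=
  (1 / (cesaroNumber α n : ℂ)) * (1 / (cesaroNumber β m : ℂ)) *
    ∑ i ∈ Finset.range (n + 1), ∑ j ∈ Finset.range (m + 1),
      (cesaroNumber (α - 1) (n - i) : ℂ) * (cesaroNumber (β - 1) (m - j) : ℂ) *
        partialSum f i j x y

end DoubleFourier

end

/-!
Summation by parts on the tail of the binomial series of `(1 - z)^α` shows that the Cesàro kernel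
of order `-α` is `2 (2 sin (t/2))^(α-1) sin(φ t) / A_n^{-α}`, with an affine phase `φ` of slope
`n + (1-α)/2`, up to `O(1 / (n t²))`. Since `A_n^{-α} ≤ (n+1)^(-α)`, integrating this kernel against
the `M` half-waves of `sin φ` on which `φ` runs from `Mπ` to `2Mπ` gives at least `M^α / 4`, for
large `M ≤ n/2`. For distinct `M = 2^k` the half-waves have disjoint supports, so in each variable
the sum of their tensor products with weights `λ_M / M` is a multiple of a single wave, and its
partial `Λ`-variation is bounded uniformly in `n`. The kernels, however, give it a contribution of
order `∑ 2^k · λ_{2^k} / (2^k)^(2-α-β)`, which diverges by Cauchy condensation. Banach–Steinhaus on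
`ℓ¹` finally yields one absolutely convergent combination of these sums on which the means are
unbounded.
-/

noncomputable section

namespace DoubleFourier

open Filter MeasureTheory Topology
open scoped BoundedContinuousFunction

/-! ### Cesàro numbers -/

@[simp]
lemma cesaroNumber_zero (a : ℝ) : cesaroNumber a 0 = 1 := by
  simp [cesaroNumber]

lemma cesaroNumber_succ (a : ℝ) (k : ℕ) :
    cesaroNumber a (k + 1) = cesaroNumber a k * ((a + (k + 1)) / (k + 1)) := by
  unfold cesaroNumber
  rw [Finset.prod_Icc_succ_top (by omega), Nat.factorial_succ]
  push_cast
  field_simp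

lemma cesaroNumber_sub_one_succ (a : ℝ) (k : ℕ) :
    cesaroNumber (a - 1) (k + 1) = a * cesaroNumber a k / (k + 1) := by
  induction k with
  | zero => simp [cesaroNumber_succ]
  | succ k ih =>
    rw [cesaroNumber_succ, ih, cesaroNumber_succ a]
    push_cast
    field_simp
    ring

lemma cesaroNumber_eq_choose (a : ℝ) (k : ℕ) : cesaroNumber a k = Ring.choose (a + k) k := by
  have prod_eq : ∏ i ∈ Finset.Icc 1 k, (a + i) = (ascPochhammer ℝ k).eval (a + 1) := by
    induction k with
    | zero => simp
    | succ k ih =>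
      rw [Finset.prod_Icc_succ_top (by omega), ih, ascPochhammer_succ_eval]
      push_cast
      ring
  rw [cesaroNumber, prod_eq, div_eq_iff (by positivity), ← Polynomial.ascPochhammer_smeval_eq_eval,
    ← Ring.factorial_nsmul_multichoose_eq_ascPochhammer, Ring.multichoose_eq, nsmul_eq_mul,
    mul_comm, add_right_comm, add_sub_cancel_right]

lemma hasSum_cesaroNumber_mul_pow (a : ℝ) {z : ℂ} (hz : ‖z‖ < 1) :
    HasSum (fun k => (cesaroNumber a k : ℂ) * z ^ k) ((1 - z) ^ (-(a + 1) : ℂ)) := by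
  have hz' : z ∈ Metric.eball (0 : ℂ) 1 := by
    rwa [← ENNReal.ofReal_one, Metric.eball_ofReal, mem_ball_zero_iff]
  have binomial := (Complex.one_div_one_sub_cpow_hasFPowerSeriesOnBall_zero (a + 1 : ℂ)).hasSum hz'
  rw [zero_add, one_div, ← Complex.cpow_neg] at binomial
  convert! binomial using 2 with k
  rw [cesaroNumber_eq_choose, FormalMultilinearSeries.ofScalars_apply_eq]
  push_cast
  rw [smul_eq_mul, add_right_comm, add_sub_cancel_right]

section NegativeOrder

variable {α : ℝ}

lemma cesaroNumber_neg_pos (hα : α < 1) (n : ℕ) : 0 < cesaroNumber (-α) n := by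
  induction n with
  | zero => simp
  | succ n ih =>
    rw [cesaroNumber_succ]
    have : (0 : ℝ) ≤ n := n.cast_nonneg
    exact mul_pos ih (div_pos (by linarith) (by positivity))

lemma antitone_cesaroNumber_neg (h0 : 0 ≤ α) (hα : α < 1) : Antitone (cesaroNumber (-α)) := by
  refine antitone_nat_of_succ_le fun n => ?_
  rw [cesaroNumber_succ]
  refine mul_le_of_le_one_right (cesaroNumber_neg_pos hα n).le ?_
  rw [div_le_one (by positivity)]
  linarith

lemma one_sub_mul_le_rpow_one_add_neg {x : ℝ} (h0 : 0 ≤ α) (hα : α ≤ 1) (hx : 0 ≤ x) :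
    1 - α * x ≤ (1 + x) ^ (-α) := by
  have bernoulli : (1 + x) ^ α ≤ 1 + α * x :=
    rpow_one_add_le_one_add_mul_self (by linarith) h0 hα
  have hpos : 0 < (1 + x) ^ α := by positivity
  rw [Real.rpow_neg (by positivity), ← one_div]
  calc 1 - α * x ≤ 1 / (1 + α * x) := by
        rw [le_div_iff₀ (by positivity)]
        nlinarith [sq_nonneg (α * x)]
    _ ≤ 1 / (1 + x) ^ α := one_div_le_one_div_of_le hpos bernoulli

lemma cesaroNumber_neg_le_rpow (h0 : 0 ≤ α) (hα : α ≤ 1) (n : ℕ) :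
    cesaroNumber (-α) n ≤ ((n : ℝ) + 1) ^ (-α) := by
  induction n with
  | zero => simp
  | succ n ih =>
    have factor_eq : (-α + (n + 1)) / ((n : ℝ) + 1) = 1 - α * (1 / (n + 1)) := by field_simp; ring
    have factor_nonneg : 0 ≤ (-α + (n + 1)) / ((n : ℝ) + 1) :=
      div_nonneg (by linarith [n.cast_nonneg (α := ℝ)]) (by positivity)
    rw [cesaroNumber_succ]
    calc cesaroNumber (-α) n * ((-α + (n + 1)) / (n + 1))
        ≤ ((n : ℝ) + 1) ^ (-α) * (1 + 1 / ((n : ℝ) + 1)) ^ (-α) := by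
          refine mul_le_mul ih ?_ factor_nonneg (by positivity)
          exact factor_eq ▸ one_sub_mul_le_rpow_one_add_neg h0 hα (by positivity)
      _ = (((n + 1 : ℕ) : ℝ) + 1) ^ (-α) := by
          rw [← Real.mul_rpow (by positivity) (by positivity)]
          congr 1
          push_cast
          field_simp

end NegativeOrder

lemma norm_one_sub_mul_sum_le_two_mul {b : ℕ → ℝ} (hb : Antitone b) (hb0 : ∀ k, 0 ≤ b k) {z : ℂ}
    (hz : ‖z‖ ≤ 1) (n : ℕ) :
    ‖(1 - z) * ∑ k ∈ Finset.range n, (b k : ℂ) * z ^ k‖ ≤ 2 * b 0 := by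
  have by_parts : (1 - z) * ∑ k ∈ Finset.range n, (b k : ℂ) * z ^ k
      = b 0 - ∑ k ∈ Finset.range n, ((b k - b (k + 1) : ℝ) : ℂ) * z ^ (k + 1) - b n * z ^ n := by
    induction n with
    | zero => simp
    | succ n ih =>
      rw [Finset.sum_range_succ, mul_add, ih, Finset.sum_range_succ]
      push_cast
      ring
  have norm_term_le : ∀ (c : ℝ) (k : ℕ), 0 ≤ c → ‖(c : ℂ) * z ^ k‖ ≤ c := fun c k hc => by
    rw [norm_mul, norm_pow, Complex.norm_of_nonneg hc]
    exact mul_le_of_le_one_right hc (pow_le_one₀ (norm_nonneg z) hz)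
  have norm_sum_le : ‖∑ k ∈ Finset.range n, ((b k - b (k + 1) : ℝ) : ℂ) * z ^ (k + 1)‖
      ≤ b 0 - b n := by
    rw [← Finset.sum_range_sub']
    exact norm_sum_le_of_le _ fun k _ => norm_term_le _ _ (sub_nonneg.2 (hb k.le_succ))
  calc _ ≤ ‖(b 0 : ℂ)‖ + (b 0 - b n) + b n := by
        rw [by_parts]
        refine (norm_sub_le _ _).trans (add_le_add ?_ (norm_term_le _ _ (hb0 n)))
        exact (norm_sub_le _ _).trans (by gcongr)
    _ = 2 * b 0 := by rw [Complex.norm_of_nonneg (hb0 0)]; ring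

lemma one_sub_mem_slitPlane {z : ℂ} (hz : ‖z‖ ≤ 1) (hz1 : z ≠ 1) : 1 - z ∈ Complex.slitPlane := by
  refine Or.inl ?_
  rw [Complex.sub_re, Complex.one_re, sub_pos]
  refine lt_of_le_of_ne ((Complex.re_le_norm z).trans hz) fun hre => hz1 ?_
  have him : z.im = 0 :=
    Complex.abs_re_eq_norm.1 ((Complex.abs_re_le_norm z).antisymm (by simpa [hre] using hz))
  exact Complex.ext hre him

section TailBound

variable {α : ℝ} (h0 : 0 ≤ α) (hα : α < 1)

include h0 hα

lemma norm_cpow_sub_sum_cesaroNumber_le_of_norm_lt_one {z : ℂ} (hz : ‖z‖ < 1) (n : ℕ) :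
    ‖(1 - z) * ((1 - z) ^ (α : ℂ) -
        ∑ k ∈ Finset.range (n + 1), (cesaroNumber (-α - 1) k : ℂ) * z ^ k)‖
      ≤ 2 * (α * cesaroNumber (-α) n / (n + 1)) := by
  set b : ℕ → ℝ := fun k => α * cesaroNumber (-α) (n + k) / ((n + k : ℕ) + 1) with hb
  have b_nonneg : ∀ k, 0 ≤ b k := fun k => by
    have := cesaroNumber_neg_pos hα (n + k)
    positivity
  have b_antitone : Antitone b := fun k l hkl => by
    have := cesaroNumber_neg_pos hα (n + k)
    have := antitone_cesaroNumber_neg h0 hα (Nat.add_le_add_left hkl n)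
    simp only [hb]
    gcongr
  have tail_eq : ∀ k, (cesaroNumber (-α - 1) (k + (n + 1)) : ℂ) * z ^ (k + (n + 1))
      = -z ^ (n + 1) * (b k * z ^ k) := fun k => by
    rw [show k + (n + 1) = n + k + 1 by omega, cesaroNumber_sub_one_succ]
    simp only [hb]
    push_cast
    ring
  have hasSum_tail : HasSum (fun k => -z ^ (n + 1) * (b k * z ^ k)) ((1 - z) ^ (α : ℂ) -
      ∑ k ∈ Finset.range (n + 1), (cesaroNumber (-α - 1) k : ℂ) * z ^ k) := by
    have h := (hasSum_nat_add_iff' (n + 1)).2 (hasSum_cesaroNumber_mul_pow (-α - 1) hz)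
    simpa only [tail_eq, Complex.ofReal_sub, Complex.ofReal_neg, Complex.ofReal_one,
      sub_add_cancel, neg_neg] using h
  refine le_of_tendsto' (hasSum_tail.tendsto_sum_nat.const_mul (1 - z)).norm fun N => ?_
  rw [← Finset.mul_sum, mul_left_comm, norm_mul, norm_neg, norm_pow]
  calc _ ≤ 1 * (2 * b 0) := mul_le_mul (pow_le_one₀ (norm_nonneg z) hz.le)
        (norm_one_sub_mul_sum_le_two_mul b_antitone b_nonneg hz.le N) (norm_nonneg _) zero_le_one
    _ = 2 * (α * cesaroNumber (-α) n / (n + 1)) := by simp [hb]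

lemma norm_cpow_sub_sum_cesaroNumber_le {z : ℂ} (hz : ‖z‖ ≤ 1) (hz1 : z ≠ 1) (n : ℕ) :
    ‖(1 - z) * ((1 - z) ^ (α : ℂ) -
        ∑ k ∈ Finset.range (n + 1), (cesaroNumber (-α - 1) k : ℂ) * z ^ k)‖
      ≤ 2 * (α * cesaroNumber (-α) n / (n + 1)) := by
  set F : ℂ → ℂ := fun w => (1 - w) * ((1 - w) ^ (α : ℂ) -
    ∑ k ∈ Finset.range (n + 1), (cesaroNumber (-α - 1) k : ℂ) * w ^ k)
  have continuousAt_F : ContinuousAt F z := by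
    have : ContinuousAt (fun w : ℂ => (1 - w) ^ (α : ℂ)) z :=
      ContinuousAt.cpow (by fun_prop) continuousAt_const (one_sub_mem_slitPlane hz hz1)
    fun_prop
  have radial : Tendsto (fun r : ℝ => (r : ℂ) * z) (𝓝[<] 1) (𝓝 z) := by
    have : Continuous fun r : ℝ => (r : ℂ) * z := by fun_prop
    simpa using (this.tendsto 1).mono_left nhdsWithin_le_nhds
  have r_pos : ∀ᶠ r : ℝ in 𝓝[<] 1, 0 < r := nhdsWithin_le_nhds (lt_mem_nhds one_pos)
  refine le_of_tendsto (continuousAt_F.tendsto.comp radial).norm ?_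
  filter_upwards [self_mem_nhdsWithin, r_pos] with r hr hr0
  refine norm_cpow_sub_sum_cesaroNumber_le_of_norm_lt_one h0 hα ?_ n
  rw [norm_mul, Complex.norm_of_nonneg hr0.le]
  exact (mul_le_of_le_one_right hr0.le hz).trans_lt hr

end TailBound

/-! ### The Cesàro kernel -/

/-- The Dirichlet kernel `∑_{|m| ≤ i} e^{-imt}`, in real form. -/
def dirichletKernel (i : ℕ) (t : ℝ) : ℝ :=
  1 + 2 * ∑ m ∈ Finset.range i, Real.cos ((m + 1) * t)

lemma dirichletKernel_succ (i : ℕ) (t : ℝ) :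
    dirichletKernel (i + 1) t = dirichletKernel i t + 2 * Real.cos ((i + 1) * t) := by
  rw [dirichletKernel, dirichletKernel, Finset.sum_range_succ]
  ring

lemma sum_exp_eq_dirichletKernel (i : ℕ) (t : ℝ) :
    ∑ m ∈ Finset.Icc (-(i : ℤ)) (i : ℤ), Complex.exp (-(Complex.I * m * t))
      = dirichletKernel i t := by
  induction i with
  | zero => simp [dirichletKernel]
  | succ i ih =>
    rw [Nat.cast_succ, Finset.sum_Icc_succ_eq_add_endpoints, ih, dirichletKernel_succ]
    push_cast
    rw [Complex.two_cos]
    ring_nf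

lemma sin_half_mul_dirichletKernel (i : ℕ) (t : ℝ) :
    Real.sin (t / 2) * dirichletKernel i t = Real.sin ((i + 1 / 2) * t) := by
  induction i with
  | zero => simp [dirichletKernel]; ring_nf
  | succ i ih =>
    rw [dirichletKernel_succ, mul_add, ih,
      show ((i : ℝ) + 1 / 2) * t = (i + 1) * t - t / 2 by ring,
      show (((i + 1 : ℕ) : ℝ) + 1 / 2) * t = (i + 1) * t + t / 2 by push_cast; ring,
      Real.sin_sub, Real.sin_add]
    ring

@[fun_prop]
lemma continuous_dirichletKernel (i : ℕ) : Continuous (dirichletKernel i) := by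
  unfold dirichletKernel
  fun_prop

/-- The kernel of the one-dimensional Cesàro means of order `a`. -/
def cesaroKernel (a : ℝ) (n : ℕ) (t : ℝ) : ℝ :=
  (∑ i ∈ Finset.range (n + 1), cesaroNumber (a - 1) (n - i) * dirichletKernel i t) /
    cesaroNumber a n

@[fun_prop]
lemma continuous_cesaroKernel (a : ℝ) (n : ℕ) : Continuous (cesaroKernel a n) := by
  unfold cesaroKernel
  fun_prop

lemma sin_half_mul_cesaroKernel {a : ℝ} {n : ℕ} (ha : cesaroNumber a n ≠ 0) (t : ℝ) :
    Real.sin (t / 2) * cesaroKernel a n t * cesaroNumber a n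
      = (Complex.exp (((n + 1 / 2) * t : ℝ) * Complex.I) *
        ∑ k ∈ Finset.range (n + 1), (cesaroNumber (a - 1) k : ℂ) *
          Complex.exp (-(t * Complex.I)) ^ k).im := by
  rw [cesaroKernel, mul_assoc, div_mul_cancel₀ _ ha, Finset.mul_sum, Finset.mul_sum,
    Complex.im_sum, ← Finset.sum_range_reflect]
  refine Finset.sum_congr rfl fun k hk => ?_
  have hkn : k ≤ n := Nat.lt_succ_iff.1 (Finset.mem_range.1 hk)
  have phase_eq : (((n + 1 / 2) * t : ℝ) : ℂ) * Complex.I + k * -(t * Complex.I)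
      = (((((n - k : ℕ) : ℝ) + 1 / 2) * t : ℝ) : ℂ) * Complex.I := by
    push_cast [hkn]
    ring
  rw [show n + 1 - 1 - k = n - k by omega, Nat.sub_sub_self hkn, mul_left_comm,
    sin_half_mul_dirichletKernel, ← Complex.exp_nat_mul, mul_left_comm, ← Complex.exp_add,
    Complex.im_ofReal_mul, phase_eq, Complex.exp_ofReal_mul_I_im]

lemma one_sub_exp_neg_mul_I (t : ℝ) :
    1 - Complex.exp (-(t * Complex.I))
      = ((2 * Real.sin (t / 2) : ℝ) : ℂ) * Complex.exp (((Real.pi - t) / 2 : ℝ) * Complex.I) := by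
  apply Complex.ext
  · rw [Complex.re_ofReal_mul, Complex.exp_ofReal_mul_I_re, ← neg_mul, ← Complex.ofReal_neg,
      Complex.sub_re, Complex.exp_ofReal_mul_I_re, Real.cos_neg,
      show (Real.pi - t) / 2 = Real.pi / 2 - t / 2 by ring, Real.cos_pi_div_two_sub,
      show t = 2 * (t / 2) by ring, Real.cos_two_mul, Real.cos_sq']
    simp
    ring
  · rw [Complex.im_ofReal_mul, Complex.exp_ofReal_mul_I_im, ← neg_mul, ← Complex.ofReal_neg,
      Complex.sub_im, Complex.exp_ofReal_mul_I_im, Real.sin_neg,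
      show (Real.pi - t) / 2 = Real.pi / 2 - t / 2 by ring, Real.sin_pi_div_two_sub,
      show t = 2 * (t / 2) by ring, Real.sin_two_mul]
    simp

lemma sin_half_pos {t : ℝ} (ht0 : 0 < t) (ht : t ≤ Real.pi) : 0 < Real.sin (t / 2) :=
  Real.sin_pos_of_pos_of_lt_pi (by linarith) (by linarith)

lemma one_sub_exp_neg_mul_I_cpow (α : ℝ) {t : ℝ} (ht0 : 0 < t) (ht : t ≤ Real.pi) :
    (1 - Complex.exp (-(t * Complex.I))) ^ (α : ℂ)
      = (((2 * Real.sin (t / 2)) ^ α : ℝ) : ℂ) *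
        Complex.exp ((α * (Real.pi - t) / 2 : ℝ) * Complex.I) := by
  have hsin := sin_half_pos ht0 ht
  have S_pos : 0 < 2 * Real.sin (t / 2) := by positivity
  have log_eq : Complex.log (Complex.exp (((Real.pi - t) / 2 : ℝ) * Complex.I))
      = ((Real.pi - t) / 2 : ℝ) * Complex.I :=
    Complex.log_exp (by simp; linarith [Real.pi_pos]) (by simp; linarith)
  rw [one_sub_exp_neg_mul_I,
    Complex.cpow_def_of_ne_zero
      (mul_ne_zero (Complex.ofReal_ne_zero.2 S_pos.ne') (Complex.exp_ne_zero _)),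
    Complex.log_ofReal_mul S_pos (Complex.exp_ne_zero _), log_eq, add_mul, Complex.exp_add,
    Real.rpow_def_of_pos S_pos, Complex.ofReal_exp]
  push_cast
  ring_nf

/-- The frequency of the principal part of the Cesàro kernel of order `-α`. -/
def kernelFreq (α : ℝ) (n : ℕ) : ℝ :=
  n + (1 - α) / 2

/-- The phase of the principal part of the Cesàro kernel of order `-α`; the waves that
resonate with the kernel begin and end where it is a multiple of `π`. -/
def kernelPhase (α : ℝ) (n : ℕ) (t : ℝ) : ℝ :=
  kernelFreq α n * t + α * Real.pi / 2

@[fun_prop]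
lemma continuous_kernelPhase (α : ℝ) (n : ℕ) : Continuous (kernelPhase α n) := by
  unfold kernelPhase
  fun_prop

lemma im_exp_mul_one_sub_exp_neg_mul_I_cpow (α : ℝ) (n : ℕ) {t : ℝ} (ht0 : 0 < t)
    (ht : t ≤ Real.pi) :
    (Complex.exp (((n + 1 / 2) * t : ℝ) * Complex.I) *
        (1 - Complex.exp (-(t * Complex.I))) ^ (α : ℂ)).im
      = (2 * Real.sin (t / 2)) ^ α * Real.sin (kernelPhase α n t) := by
  rw [one_sub_exp_neg_mul_I_cpow α ht0 ht, mul_left_comm, Complex.im_ofReal_mul,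
    ← Complex.exp_add, ← add_mul, ← Complex.ofReal_add, Complex.exp_ofReal_mul_I_im, kernelPhase,
    kernelFreq]
  ring_nf

lemma two_mul_sin_half_mul_abs_sub_le {α : ℝ} (h0 : 0 ≤ α) (hα : α < 1) (n : ℕ) {t : ℝ}
    (ht0 : 0 < t) (ht : t ≤ Real.pi) :
    2 * Real.sin (t / 2) * |2 * Real.sin (t / 2) * cesaroKernel (-α) n t * cesaroNumber (-α) n -
        2 * ((2 * Real.sin (t / 2)) ^ α * Real.sin (kernelPhase α n t))|
      ≤ 4 * α * cesaroNumber (-α) n / (n + 1) := by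
  have hsin := sin_half_pos ht0 ht
  set z := Complex.exp (-(t * Complex.I)) with hz
  set phase := Complex.exp (((n + 1 / 2) * t : ℝ) * Complex.I) with hphase
  set P := ∑ k ∈ Finset.range (n + 1), (cesaroNumber (-α - 1) k : ℂ) * z ^ k
  have norm_z : ‖z‖ = 1 := by
    rw [hz, ← neg_mul, ← Complex.ofReal_neg, Complex.norm_exp_ofReal_mul_I]
  have norm_one_sub_z : ‖1 - z‖ = 2 * Real.sin (t / 2) := by
    rw [hz, one_sub_exp_neg_mul_I, norm_mul, Complex.norm_exp_ofReal_mul_I, mul_one,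
      Complex.norm_of_nonneg (by positivity)]
  have z_ne_one : z ≠ 1 := fun h => by
    rw [h, sub_self, norm_zero] at norm_one_sub_z
    linarith
  have kernel_eq : 2 * Real.sin (t / 2) * cesaroKernel (-α) n t * cesaroNumber (-α) n
      = 2 * (phase * P).im := by
    rw [← sin_half_mul_cesaroKernel (cesaroNumber_neg_pos hα n).ne']
    ring
  have im_le : |(phase * P).im - (phase * (1 - z) ^ (α : ℂ)).im| ≤ ‖(1 - z) ^ (α : ℂ) - P‖ := by
    rw [← Complex.sub_im, ← mul_sub]
    refine (Complex.abs_im_le_norm _).trans_eq ?_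
    rw [norm_mul, hphase, Complex.norm_exp_ofReal_mul_I, one_mul, norm_sub_rev]
  rw [kernel_eq, ← im_exp_mul_one_sub_exp_neg_mul_I_cpow α n ht0 ht, ← mul_sub, abs_mul, abs_two]
  calc _ ≤ 2 * Real.sin (t / 2) * (2 * ‖(1 - z) ^ (α : ℂ) - P‖) := by gcongr
    _ = 2 * ‖(1 - z) * ((1 - z) ^ (α : ℂ) - P)‖ := by rw [norm_mul, norm_one_sub_z]; ring
    _ ≤ 2 * (2 * (α * cesaroNumber (-α) n / (n + 1))) := by
        gcongr
        exact norm_cpow_sub_sum_cesaroNumber_le h0 hα norm_z.le z_ne_one n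
    _ = 4 * α * cesaroNumber (-α) n / (n + 1) := by ring

lemma abs_cesaroKernel_sub_le {α : ℝ} (h0 : 0 ≤ α) (hα : α < 1) (n : ℕ) {t : ℝ} (ht0 : 0 < t)
    (ht : t ≤ Real.pi) :
    |cesaroKernel (-α) n t - 2 * (2 * Real.sin (t / 2)) ^ (α - 1) * Real.sin (kernelPhase α n t) /
        cesaroNumber (-α) n| ≤ 4 * α / ((n + 1) * (2 * Real.sin (t / 2)) ^ 2) := by
  have hA := cesaroNumber_neg_pos hα n
  have hsin := sin_half_pos ht0 ht
  have key := two_mul_sin_half_mul_abs_sub_le h0 hα n ht0 ht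
  set S := 2 * Real.sin (t / 2) with hS
  have S_pos : 0 < S := by positivity
  have diff_eq : S * cesaroKernel (-α) n t * cesaroNumber (-α) n -
      2 * (S ^ α * Real.sin (kernelPhase α n t)) = S * cesaroNumber (-α) n *
        (cesaroKernel (-α) n t - 2 * S ^ (α - 1) * Real.sin (kernelPhase α n t) /
          cesaroNumber (-α) n) := by
    rw [Real.rpow_sub_one S_pos.ne']
    field_simp
  rw [diff_eq, abs_mul, abs_of_pos (by positivity)] at key
  rw [le_div_iff₀ (by positivity)]
  rw [le_div_iff₀ (by positivity)] at key
  refine le_of_mul_le_mul_right ?_ hA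
  linarith

/-! ### Cesàro means as integrals against the kernel -/

/-- The square of periods `[0, 2π]²`. -/
def periodSquare : Set (ℝ × ℝ) :=
  Set.Icc 0 (2 * Real.pi) ×ˢ Set.Icc 0 (2 * Real.pi)

lemma isCompact_periodSquare : IsCompact periodSquare :=
  isCompact_Icc.prod isCompact_Icc

section PeriodSquare

variable {E : Type*} [NormedAddCommGroup E] {F : ℝ × ℝ → E}

lemma integrableOn_periodSquare (hF : Continuous F) : IntegrableOn F periodSquare :=
  hF.continuousOn.integrableOn_compact isCompact_periodSquare

lemma intervalIntegral_intervalIntegral_eq_periodSquare [NormedSpace ℝ E] (hF : Continuous F) :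
    ∫ y in (0 : ℝ)..(2 * Real.pi), ∫ x in (0 : ℝ)..(2 * Real.pi), F (x, y)
      = ∫ p in periodSquare, F p := by
  simp only [intervalIntegral.integral_of_le Real.two_pi_pos.le, ← integral_Icc_eq_integral_Ioc]
  exact (setIntegral_prod (fun p : ℝ × ℝ => F p.swap)
    (integrableOn_periodSquare (hF.comp continuous_swap))).symm.trans (setIntegral_prod_swap _ _ F)

end PeriodSquare

lemma integral_periodSquare_mul_sum_mul_sum {f : ℝ × ℝ → ℂ} (hf : Continuous f) {ι κ : Type*}
    (s : Finset ι) (t : Finset κ) (g : ι → ℝ → ℂ) (h : κ → ℝ → ℂ) (hg : ∀ i, Continuous (g i))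
    (hh : ∀ j, Continuous (h j)) :
    ∫ p in periodSquare, f p * ((∑ i ∈ s, g i p.1) * ∑ j ∈ t, h j p.2)
      = ∑ i ∈ s, ∑ j ∈ t, ∫ p in periodSquare, f p * (g i p.1 * h j p.2) := by
  simp_rw [Finset.sum_mul_sum, Finset.mul_sum]
  have integrable_term : ∀ i j,
      IntegrableOn (fun p : ℝ × ℝ => f p * (g i p.1 * h j p.2)) periodSquare := fun i j =>
    integrableOn_periodSquare (by fun_prop)
  rw [integral_finsetSum _ fun i _ => integrable_finsetSum _ fun j _ => integrable_term i j]
  exact Finset.sum_congr rfl fun i _ => integral_finsetSum _ fun j _ => integrable_term i j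

lemma partialSum_zero {f : ℝ → ℝ → ℝ} (hf : Continuous fun p : ℝ × ℝ => f p.1 p.2) (M N : ℕ) :
    partialSum f M N 0 0 = 1 / (4 * (Real.pi : ℂ) ^ 2) * ∫ p in periodSquare,
      (f p.1 p.2 : ℂ) * (dirichletKernel M p.1 * dirichletKernel N p.2) := by
  have fourierCoeff_eq : ∀ m n : ℤ, fourierCoeff₂ f m n = 1 / (4 * (Real.pi : ℂ) ^ 2) *
      ∫ p in periodSquare, (f p.1 p.2 : ℂ) *
        (Complex.exp (-(Complex.I * m * p.1)) * Complex.exp (-(Complex.I * n * p.2))) := by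
    intro m n
    rw [fourierCoeff₂, ← intervalIntegral_intervalIntegral_eq_periodSquare (by fun_prop)]
    simp only [mul_assoc]
  simp only [partialSum, Complex.ofReal_zero, mul_zero, Complex.exp_zero, mul_one,
    fourierCoeff_eq, ← Finset.mul_sum, ← sum_exp_eq_dirichletKernel]
  rw [← integral_periodSquare_mul_sum_mul_sum (by fun_prop) _ _
    (fun (m : ℤ) t => Complex.exp (-(Complex.I * m * t)))
    (fun (n : ℤ) t => Complex.exp (-(Complex.I * n * t))) (fun m => by fun_prop)
    (fun n => by fun_prop)]

lemma cesaroKernel_ofReal (a : ℝ) (n : ℕ) (t : ℝ) :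
    (cesaroKernel a n t : ℂ) = ∑ i ∈ Finset.range (n + 1),
      (cesaroNumber (a - 1) (n - i) / cesaroNumber a n : ℂ) * dirichletKernel i t := by
  rw [cesaroKernel]
  push_cast
  rw [Finset.sum_div]
  exact Finset.sum_congr rfl fun i _ => by ring

lemma cesaroMean_zero (a b : ℝ) {f : ℝ → ℝ → ℝ} (hf : Continuous fun p : ℝ × ℝ => f p.1 p.2)
    (n m : ℕ) :
    cesaroMean a b f n m 0 0 = ((1 / (4 * Real.pi ^ 2) * ∫ p in periodSquare,
      f p.1 p.2 * (cesaroKernel a n p.1 * cesaroKernel b m p.2) : ℝ) : ℂ) := by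
  have pull_const : ∀ (c d : ℂ) (i j : ℕ), ∫ p in periodSquare,
      (f p.1 p.2 : ℂ) * (c * dirichletKernel i p.1 * (d * dirichletKernel j p.2))
        = c * d * ∫ p in periodSquare,
          (f p.1 p.2 : ℂ) * (dirichletKernel i p.1 * dirichletKernel j p.2) := by
    intro c d i j
    rw [← integral_const_mul]
    exact integral_congr_ae (.of_forall fun p => by ring)
  rw [Complex.ofReal_mul, ← integral_complex_ofReal]
  simp only [Complex.ofReal_mul, cesaroKernel_ofReal]
  rw [integral_periodSquare_mul_sum_mul_sum (by fun_prop) _ _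
    (fun i t => (cesaroNumber (a - 1) (n - i) / cesaroNumber a n : ℂ) * dirichletKernel i t)
    (fun j t => (cesaroNumber (b - 1) (m - j) / cesaroNumber b m : ℂ) * dirichletKernel j t)
    (fun i => by fun_prop) (fun j => by fun_prop), cesaroMean]
  simp only [pull_const, partialSum_zero hf, Finset.mul_sum]
  refine Finset.sum_congr rfl fun i _ => Finset.sum_congr rfl fun j _ => ?_
  push_cast
  ring

/-- Integration over the square of periods against the product of two Cesàro kernels, as a
functional on bounded continuous functions. Up to the factor `1 / 4π²` it is the Cesàro mean at the
origin. -/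
def kernelFunctional (a b : ℝ) (n m : ℕ) : ((ℝ × ℝ) →ᵇ ℝ) →L[ℝ] ℝ :=
  LinearMap.mkContinuous
    { toFun := fun F => ∫ p in periodSquare, F p * (cesaroKernel a n p.1 * cesaroKernel b m p.2)
      map_add' := fun F G => by
        simp only [BoundedContinuousFunction.add_apply, add_mul]
        exact integral_add (integrableOn_periodSquare (by fun_prop))
          (integrableOn_periodSquare (by fun_prop))
      map_smul' := fun c F => by
        simp only [BoundedContinuousFunction.smul_apply, smul_eq_mul, mul_assoc,
          integral_const_mul, RingHom.id_apply] }
    (∫ p in periodSquare, |cesaroKernel a n p.1 * cesaroKernel b m p.2|) fun F => by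
      rw [mul_comm, ← integral_const_mul]
      refine norm_integral_le_of_norm_le (integrableOn_periodSquare (by fun_prop))
        (.of_forall fun p => ?_)
      rw [norm_mul]
      exact mul_le_mul_of_nonneg_right (F.norm_coe_le_norm p) (norm_nonneg _)

lemma kernelFunctional_apply (a b : ℝ) (n m : ℕ) (F : (ℝ × ℝ) →ᵇ ℝ) :
    kernelFunctional a b n m F
      = ∫ p in periodSquare, F p * (cesaroKernel a n p.1 * cesaroKernel b m p.2) :=
  rfl

lemma integral_periodSquare_mul (u v : ℝ → ℝ) :
    ∫ p in periodSquare, u p.1 * v p.2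
      = (∫ x in (0 : ℝ)..(2 * Real.pi), u x) * ∫ y in (0 : ℝ)..(2 * Real.pi), v y := by
  simp only [intervalIntegral.integral_of_le Real.two_pi_pos.le, ← integral_Icc_eq_integral_Ioc]
  exact setIntegral_prod_mul u v _ _

/-! ### Weighted variation -/

section WeightedVariation

variable (E : IntervalFamily) {lam : ℕ → ℝ}

lemma IntervalFamily.sum_increments_le {φ : ℝ → ℝ} (hφ : Monotone φ) (hc : Continuous φ) :
    ∑ i, (φ (E.right i) - φ (E.left i)) ≤ φ (2 * Real.pi) - φ 0 := by
  let F : StieltjesFunction ℝ := ⟨φ, hφ, fun x => hc.continuousWithinAt⟩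
  have hF : ∀ x, F x = φ x := fun x => rfl
  have hl : ∀ x, Function.leftLim F x = φ x := fun x =>
    ContinuousWithinAt.leftLim_eq (f := F) hc.continuousWithinAt
  have hunion : F.measure (⋃ i ∈ Finset.univ, Set.Ioo (E.left i) (E.right i))
      ≤ F.measure (Set.Icc 0 (2 * Real.pi)) :=
    measure_mono <| Set.iUnion₂_subset fun i _ _ hx =>
      ⟨(E.left_nonneg i).trans hx.1.le, hx.2.le.trans (E.right_le i)⟩
  rw [measure_biUnion_finset (fun i _ j _ hij => E.nonoverlapping i j hij)
    fun i _ => measurableSet_Ioo] at hunion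
  simp only [StieltjesFunction.measure_Icc, StieltjesFunction.measure_Ioo, hl, hF] at hunion
  rw [← ENNReal.ofReal_sum_of_nonneg
    fun i _ => sub_nonneg.2 (hφ (E.left_lt_right i).le)] at hunion
  exact (ENNReal.ofReal_le_ofReal_iff (sub_nonneg.2 (hφ Real.two_pi_pos.le))).1 hunion

lemma IntervalFamily.weightedSum_nonneg (hpos : ∀ k, 1 ≤ k → 0 < lam k) (g : ℝ → ℝ) :
    0 ≤ E.weightedSum lam g :=
  Finset.sum_nonneg fun i _ => div_nonneg (abs_nonneg _) (hpos _ (by omega)).le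

lemma IntervalFamily.weightedSum_const_mul (c : ℝ) (g : ℝ → ℝ) :
    E.weightedSum lam (fun x => c * g x) = |c| * E.weightedSum lam g := by
  simp only [weightedSum, ← mul_sub, abs_mul, mul_div_assoc, Finset.mul_sum]

lemma IntervalFamily.weightedSum_sum_le (hpos : ∀ k, 1 ≤ k → 0 < lam k) {ι : Type*}
    (s : Finset ι) (g : ι → ℝ → ℝ) :
    E.weightedSum lam (fun x => ∑ j ∈ s, g j x) ≤ ∑ j ∈ s, E.weightedSum lam (g j) := by
  simp only [weightedSum, ← Finset.sum_sub_distrib]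
  rw [Finset.sum_comm]
  simp only [← Finset.sum_div]
  gcongr with i
  · exact (hpos _ (by omega)).le
  · exact Finset.abs_sum_le_sum_abs _ _

lemma IntervalFamily.weightedSum_le_of_hasSum (hpos : ∀ k, 1 ≤ k → 0 < lam k) {ι : Type*}
    {c : ι → ℝ} (hc : Summable fun j => |c j|) {g : ι → ℝ → ℝ} {G : ℝ → ℝ} {V : ℝ}
    (hV0 : 0 ≤ V) (hG : ∀ x, HasSum (fun j => c j * g j x) (G x))
    (hV : ∀ j, E.weightedSum lam (g j) ≤ V) :
    E.weightedSum lam G ≤ (∑' j, |c j|) * V := by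
  have hlim : Tendsto (fun s : Finset ι => E.weightedSum lam fun x => ∑ j ∈ s, c j * g j x) atTop
      (𝓝 (E.weightedSum lam G)) :=
    tendsto_finsetSum _ fun i _ =>
      ((Tendsto.sub (hG (E.right i)) (hG (E.left i))).abs).div_const (lam (i.val + 1))
  refine le_of_tendsto' hlim fun s => ?_
  calc E.weightedSum lam (fun x => ∑ j ∈ s, c j * g j x)
      ≤ ∑ j ∈ s, E.weightedSum lam (fun x => c j * g j x) := E.weightedSum_sum_le hpos s _
    _ = ∑ j ∈ s, |c j| * E.weightedSum lam (g j) := by simp only [weightedSum_const_mul]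
    _ ≤ ∑ j ∈ s, |c j| * V := by gcongr with j; exact hV j
    _ = (∑ j ∈ s, |c j|) * V := by rw [Finset.sum_mul]
    _ ≤ (∑' j, |c j|) * V := by
      gcongr
      exact hc.sum_le_tsum s fun j _ => abs_nonneg _

/-- The first `M` intervals of the family are charged the oscillation of `g`, the remaining ones
the increment of `φ`. -/
lemma IntervalFamily.weightedSum_le (hpos : ∀ k, 1 ≤ k → 0 < lam k)
    (hmono : MonotoneOn lam (Set.Ici 1)) {g φ : ℝ → ℝ} {B : ℝ} (hg : ∀ x, |g x| ≤ B)
    (hφ : Monotone φ) (hc : Continuous φ)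
    (hgφ : ∀ x ∈ Set.Icc 0 (2 * Real.pi), ∀ y ∈ Set.Icc 0 (2 * Real.pi), x ≤ y →
      |g y - g x| ≤ φ y - φ x) {M : ℕ} (hM : 1 ≤ M) :
    E.weightedSum lam g
      ≤ 2 * B * ∑ k ∈ Finset.range M, 1 / lam (k + 1) + (φ (2 * Real.pi) - φ 0) / lam M := by
  have hB : 0 ≤ B := (abs_nonneg _).trans (hg 0)
  have hMp := hpos M hM
  have hearly : ∑ i : Fin E.card, (if i.val < M then 2 * B / lam (i.val + 1) else 0)
      ≤ 2 * B * ∑ k ∈ Finset.range M, 1 / lam (k + 1) := by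
    rw [Fin.sum_univ_eq_sum_range (fun i => if i < M then 2 * B / lam (i + 1) else 0),
      ← Finset.sum_filter, Finset.mul_sum]
    simp only [mul_one_div]
    refine Finset.sum_le_sum_of_subset_of_nonneg (fun i hi => ?_) fun i _ _ => ?_
    · exact Finset.mem_range.2 (Finset.mem_filter.1 hi).2
    · exact div_nonneg (by positivity) (hpos _ (by omega)).le
  have hterm : ∀ i : Fin E.card, |g (E.right i) - g (E.left i)| / lam (i.val + 1)
      ≤ (if i.val < M then 2 * B / lam (i.val + 1) else 0)
        + (φ (E.right i) - φ (E.left i)) / lam M := by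
    intro i
    have hi := hpos (i.val + 1) (by omega)
    have hlr := (E.left_lt_right i).le
    have hinc := sub_nonneg.2 (hφ hlr)
    split_ifs with h
    · have hosc : |g (E.right i) - g (E.left i)| ≤ 2 * B := by
        linarith [abs_sub (g (E.right i)) (g (E.left i)), hg (E.right i), hg (E.left i)]
      exact (div_le_div_of_nonneg_right hosc hi.le).trans (le_add_of_nonneg_right (by positivity))
    · have hl : lam M ≤ lam (i.val + 1) := hmono hM (Set.mem_Ici.2 (by omega)) (by omega)
      have hmem := hgφ (E.left i) ⟨E.left_nonneg i, hlr.trans (E.right_le i)⟩ (E.right i)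
        ⟨(E.left_nonneg i).trans hlr, E.right_le i⟩ hlr
      rw [zero_add]
      gcongr
  refine (Finset.sum_le_sum fun i _ => hterm i).trans ?_
  rw [Finset.sum_add_distrib, ← Finset.sum_div]
  have := E.sum_increments_le hφ hc
  gcongr

end WeightedVariation

lemma mul_rpow_sub_one_le_rpow_sub_rpow {s x : ℝ} (h0 : 0 ≤ s) (h1 : s ≤ 1) (hx : 0 ≤ x) :
    s * (x + 1) ^ (s - 1) ≤ (x + 1) ^ s - x ^ s := by
  have hx1 : 0 < x + 1 := by positivity
  have hbernoulli := rpow_one_add_le_one_add_mul_self (s := -(1 / (x + 1)))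
    (neg_le_neg ((div_le_one hx1).2 (by linarith))) h0 h1
  have hfactor : x ^ s = (x + 1) ^ s * (1 + -(1 / (x + 1))) ^ s := by
    have : 1 + -(1 / (x + 1)) = x / (x + 1) := by field_simp; ring
    rw [this, ← Real.mul_rpow hx1.le (by positivity), mul_div_cancel₀ _ hx1.ne']
  have hle : x ^ s ≤ (x + 1) ^ s * (1 + s * -(1 / (x + 1))) := by
    rw [hfactor]
    gcongr
  rw [Real.rpow_sub_one hx1.ne']
  linear_combination hle

lemma sum_range_rpow_sub_one_le {s : ℝ} (h0 : 0 < s) (h1 : s ≤ 1) (M : ℕ) :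
    ∑ k ∈ Finset.range M, ((k : ℝ) + 1) ^ (s - 1) ≤ (M : ℝ) ^ s / s := by
  rw [le_div_iff₀' h0, Finset.mul_sum]
  calc ∑ k ∈ Finset.range M, s * ((k : ℝ) + 1) ^ (s - 1)
      ≤ ∑ k ∈ Finset.range M, (((k + 1 : ℕ) : ℝ) ^ s - (k : ℝ) ^ s) := by
        gcongr with k
        exact_mod_cast mul_rpow_sub_one_le_rpow_sub_rpow h0.le h1 k.cast_nonneg
    _ = (M : ℝ) ^ s := by
        rw [Finset.sum_range_sub fun k : ℕ => (k : ℝ) ^ s]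
        simp [h0.ne']

lemma sum_one_div_le {lam : ℕ → ℝ} {s : ℝ} (h0 : 0 < s) (h1 : s ≤ 1)
    (hpos : ∀ k, 1 ≤ k → 0 < lam k)
    (hanti : AntitoneOn (fun k : ℕ => lam k / (k : ℝ) ^ (1 - s)) (Set.Ici 1)) {M : ℕ}
    (hM : 1 ≤ M) :
    ∑ k ∈ Finset.range M, 1 / lam (k + 1) ≤ M / lam M / s := by
  have hMp := hpos M hM
  have hM0 : (0 : ℝ) < M := by exact_mod_cast hM
  have hterm : ∀ k ∈ Finset.range M,
      1 / lam (k + 1) ≤ (M : ℝ) ^ (1 - s) / lam M * ((k : ℝ) + 1) ^ (s - 1) := by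
    intro k hk
    have hratio : lam M / (M : ℝ) ^ (1 - s) ≤ lam (k + 1) / ((k + 1 : ℕ) : ℝ) ^ (1 - s) :=
      hanti (Set.mem_Ici.2 (by omega)) hM (Finset.mem_range.1 hk)
    have hk1 := hpos (k + 1) (by omega)
    push_cast at hratio
    rw [div_le_div_iff₀ (by positivity) (by positivity)] at hratio
    rw [← neg_sub 1 s, Real.rpow_neg (by positivity), ← div_eq_mul_inv, div_div,
      div_le_div_iff₀ hk1 (by positivity)]
    linarith
  calc ∑ k ∈ Finset.range M, 1 / lam (k + 1)
      ≤ (M : ℝ) ^ (1 - s) / lam M * ∑ k ∈ Finset.range M, ((k : ℝ) + 1) ^ (s - 1) := by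
        rw [Finset.mul_sum]
        exact Finset.sum_le_sum hterm
    _ ≤ (M : ℝ) ^ (1 - s) / lam M * ((M : ℝ) ^ s / s) := by
        gcongr
        exact sum_range_rpow_sub_one_le h0 h1 M
    _ = M ^ (1 - s + s) / lam M / s := by
        rw [Real.rpow_add hM0]
        ring
    _ = M / lam M / s := by simp

/-! ### Truncated waves -/

/-- The `2π`-periodic function that agrees with `g` on `[0, 2π)`. -/
def periodize (g : ℝ → ℝ) (t : ℝ) : ℝ := g (2 * Real.pi * Int.fract (t / (2 * Real.pi)))

lemma periodize_periodic (g : ℝ → ℝ) : Function.Periodic (periodize g) (2 * Real.pi) := fun t => by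
  rw [periodize, add_div, div_self Real.two_pi_pos.ne', Int.fract_add_one, periodize]

lemma continuous_periodize {g : ℝ → ℝ} (hg : Continuous g) (h : g 0 = g (2 * Real.pi)) :
    Continuous (periodize g) :=
  (ContinuousOn.comp_fract'' (f := fun u => g (2 * Real.pi * u)) (by fun_prop)
    (by simpa using h)).comp (continuous_id.div_const (2 * Real.pi))

lemma periodize_eq {g : ℝ → ℝ} (h : g 0 = g (2 * Real.pi)) {t : ℝ}
    (ht : t ∈ Set.Icc 0 (2 * Real.pi)) : periodize g t = g t := by
  have hp := Real.two_pi_pos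
  rcases ht.2.eq_or_lt with rfl | hlt
  · rw [periodize, div_self hp.ne', Int.fract_one, mul_zero, h]
  · rw [periodize, Int.fract_eq_self.2 ⟨div_nonneg ht.1 hp.le, (div_lt_one hp).2 hlt⟩,
      mul_div_cancel₀ _ hp.ne']

/-- The phase of the kernel, truncated to `M` half-periods. -/
def clippedPhase (α : ℝ) (n M : ℕ) (t : ℝ) : ℝ :=
  max (M * Real.pi) (min (2 * M * Real.pi) (kernelPhase α n t))

/-- `M` consecutive half-waves of the principal part of the kernel, extended by zero. -/
def wave (α : ℝ) (n M : ℕ) (t : ℝ) : ℝ := Real.sin (clippedPhase α n M t)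

/-- The `2π`-periodic extension of the restriction of `wave` to a period. -/
def periodicWave (α : ℝ) (n M : ℕ) : ℝ → ℝ := periodize (wave α n M)

section Wave

variable {α : ℝ} {n M : ℕ}

@[fun_prop]
lemma continuous_clippedPhase (α : ℝ) (n M : ℕ) : Continuous (clippedPhase α n M) := by
  unfold clippedPhase; fun_prop

@[fun_prop]
lemma continuous_wave (α : ℝ) (n M : ℕ) : Continuous (wave α n M) := by
  unfold wave; fun_prop

lemma monotone_kernelPhase (hα : α ≤ 1) (n : ℕ) : Monotone (kernelPhase α n) := by
  intro x y hxy
  have : 0 ≤ (1 - α) / 2 := by linarith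
  unfold kernelPhase kernelFreq
  gcongr

lemma monotone_clippedPhase (hα : α ≤ 1) (n M : ℕ) : Monotone (clippedPhase α n M) :=
  monotone_const.max (monotone_const.min (monotone_kernelPhase hα n))

lemma clippedPhase_sub_le (α : ℝ) (n M : ℕ) (x y : ℝ) :
    clippedPhase α n M y - clippedPhase α n M x ≤ M * Real.pi := by
  have hlower : (M : ℝ) * Real.pi ≤ clippedPhase α n M x := le_max_left _ _
  have hupper : clippedPhase α n M y ≤ 2 * M * Real.pi :=
    max_le (by nlinarith [Real.pi_pos, M.cast_nonneg (α := ℝ)]) (min_le_left _ _)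
  linarith

lemma wave_eq_zero_of_le {t : ℝ} (h : kernelPhase α n t ≤ M * Real.pi) : wave α n M t = 0 := by
  rw [wave, clippedPhase, max_eq_left ((min_le_right _ _).trans h), Real.sin_nat_mul_pi]

lemma wave_eq_zero_of_ge {t : ℝ} (h : 2 * M * Real.pi ≤ kernelPhase α n t) :
    wave α n M t = 0 := by
  have hle : (M : ℝ) * Real.pi ≤ 2 * M * Real.pi := by
    nlinarith [Real.pi_pos, M.cast_nonneg (α := ℝ)]
  rw [wave, clippedPhase, min_eq_left h, max_eq_right hle]
  exact_mod_cast Real.sin_nat_mul_pi (2 * M)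

lemma wave_eq_sin {t : ℝ} (h1 : M * Real.pi ≤ kernelPhase α n t)
    (h2 : kernelPhase α n t ≤ 2 * M * Real.pi) : wave α n M t = Real.sin (kernelPhase α n t) := by
  rw [wave, clippedPhase, min_eq_right h2, max_eq_right h1]

lemma wave_zero (hα : α ≤ 1) (n : ℕ) (hM : 1 ≤ M) : wave α n M 0 = 0 := by
  have hM' : (1 : ℝ) ≤ M := by exact_mod_cast hM
  refine wave_eq_zero_of_le ?_
  rw [kernelPhase]
  nlinarith [Real.pi_pos]

lemma wave_two_pi (hα : α ≤ 1) (hMn : M ≤ n) : wave α n M (2 * Real.pi) = 0 := by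
  have hMn' : (M : ℝ) ≤ n := by exact_mod_cast hMn
  refine wave_eq_zero_of_ge ?_
  rw [kernelPhase, kernelFreq]
  nlinarith [mul_nonneg (sub_nonneg.2 hα) Real.pi_pos.le, Real.pi_pos]

lemma wave_zero_eq_wave_two_pi (hα : α ≤ 1) (hM : 1 ≤ M) (hMn : M ≤ n) :
    wave α n M 0 = wave α n M (2 * Real.pi) :=
  (wave_zero hα n hM).trans (wave_two_pi hα hMn).symm

lemma abs_periodicWave_le_one (α : ℝ) (n M : ℕ) (t : ℝ) : |periodicWave α n M t| ≤ 1 :=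
  Real.abs_sin_le_one _

lemma continuous_periodicWave (hα : α ≤ 1) (hM : 1 ≤ M) (hMn : M ≤ n) :
    Continuous (periodicWave α n M) :=
  continuous_periodize (continuous_wave α n M) (wave_zero_eq_wave_two_pi hα hM hMn)

lemma periodicWave_eq_wave (hα : α ≤ 1) (hM : 1 ≤ M) (hMn : M ≤ n) {t : ℝ}
    (ht : t ∈ Set.Icc 0 (2 * Real.pi)) : periodicWave α n M t = wave α n M t :=
  periodize_eq (wave_zero_eq_wave_two_pi hα hM hMn) ht

lemma abs_wave_sub_le (hα : α ≤ 1) {x y : ℝ} (hxy : x ≤ y) :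
    |wave α n M y - wave α n M x| ≤ clippedPhase α n M y - clippedPhase α n M x := by
  rw [← abs_of_nonneg (sub_nonneg.2 (monotone_clippedPhase hα n M hxy))]
  exact Real.abs_sin_sub_sin_le _ _

lemma weightedSum_periodicWave_le (hα : α ≤ 1) (hM : 1 ≤ M) (hMn : M ≤ n) {lam : ℕ → ℝ} {s : ℝ}
    (hs0 : 0 < s) (hs1 : s ≤ 1) (hpos : ∀ k, 1 ≤ k → 0 < lam k)
    (hmono : MonotoneOn lam (Set.Ici 1))
    (hanti : AntitoneOn (fun k : ℕ => lam k / (k : ℝ) ^ (1 - s)) (Set.Ici 1))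
    (E : IntervalFamily) :
    lam M / M * E.weightedSum lam (periodicWave α n M) ≤ 2 / s + Real.pi := by
  have hMp := hpos M hM
  have : (0 : ℝ) < M := by exact_mod_cast hM
  have hincr : ∀ x ∈ Set.Icc 0 (2 * Real.pi), ∀ y ∈ Set.Icc 0 (2 * Real.pi), x ≤ y →
      |periodicWave α n M y - periodicWave α n M x|
        ≤ clippedPhase α n M y - clippedPhase α n M x := fun x hx y hy hxy => by
    rw [periodicWave_eq_wave hα hM hMn hx, periodicWave_eq_wave hα hM hMn hy]
    exact abs_wave_sub_le hα hxy
  have hsum := sum_one_div_le hs0 hs1 hpos hanti hM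
  have hphase := clippedPhase_sub_le α n M 0 (2 * Real.pi)
  calc lam M / M * E.weightedSum lam (periodicWave α n M)
      ≤ lam M / M * (2 * 1 * (M / lam M / s) + M * Real.pi / lam M) := by
        gcongr
        exact (E.weightedSum_le hpos hmono (abs_periodicWave_le_one α n M)
          (monotone_clippedPhase hα n M) (continuous_clippedPhase α n M) hincr hM).trans
          (by gcongr)
    _ = 2 / s + Real.pi := by field_simp

end Wave

/-! ### Lower bound for the integral of a wave against the kernel -/

section Resonance

variable {α : ℝ} {n M : ℕ}

/-- The point at which the phase of the kernel equals `u`; a wave of `M` half-periods lives between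
the points with phase `M π` and `2 M π`. -/
def phasePoint (α : ℝ) (n : ℕ) (u : ℝ) : ℝ := (u - α * Real.pi / 2) / kernelFreq α n

lemma kernelFreq_pos (hα : α < 1) (n : ℕ) : 0 < kernelFreq α n := by
  have : 0 < (1 - α) / 2 := by linarith
  unfold kernelFreq
  positivity

lemma kernelPhase_phasePoint (hα : α < 1) (n : ℕ) (u : ℝ) :
    kernelPhase α n (phasePoint α n u) = u := by
  rw [kernelPhase, phasePoint, mul_div_cancel₀ _ (kernelFreq_pos hα n).ne', sub_add_cancel]

lemma le_kernelPhase_iff (hα : α < 1) {u t : ℝ} : u ≤ kernelPhase α n t ↔ phasePoint α n u ≤ t := by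
  rw [kernelPhase, phasePoint, div_le_iff₀' (kernelFreq_pos hα n), sub_le_iff_le_add]

lemma kernelPhase_le_iff (hα : α < 1) {u t : ℝ} : kernelPhase α n t ≤ u ↔ t ≤ phasePoint α n u := by
  rw [kernelPhase, phasePoint, le_div_iff₀' (kernelFreq_pos hα n), le_sub_iff_add_le]

lemma div_kernelFreq_le_phasePoint (hα : α < 1) (hM : 1 ≤ M) :
    M * Real.pi / (2 * kernelFreq α n) ≤ phasePoint α n (M * Real.pi) := by
  have hM' : (1 : ℝ) ≤ M := by exact_mod_cast hM
  have hν := kernelFreq_pos hα n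
  rw [phasePoint, div_le_div_iff₀ (by positivity) hν]
  nlinarith [mul_nonneg (mul_nonneg (sub_nonneg.2 (hα.le.trans hM')) Real.pi_pos.le) hν.le]

lemma phasePoint_le_div_kernelFreq (h0 : 0 ≤ α) (hα : α < 1) (n : ℕ) (u : ℝ) :
    phasePoint α n u ≤ u / kernelFreq α n := by
  have hν := kernelFreq_pos hα n
  unfold phasePoint
  gcongr
  exact sub_le_self _ (by positivity)

lemma div_kernelFreq_le_pi (hα : α < 1) (hMn : 2 * M ≤ n) :
    2 * M * Real.pi / kernelFreq α n ≤ Real.pi := by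
  have hMn' : 2 * (M : ℝ) ≤ n := by exact_mod_cast hMn
  rw [div_le_iff₀ (kernelFreq_pos hα n), mul_comm Real.pi]
  gcongr
  exact hMn'.trans (le_add_of_nonneg_right (by linarith))

lemma two_mul_div_pi_le_two_mul_sin_half {t : ℝ} (h0 : 0 ≤ t) (ht : t ≤ Real.pi) :
    2 * t / Real.pi ≤ 2 * Real.sin (t / 2) := by
  have := Real.mul_le_sin (x := t / 2) (by linarith) (by linarith)
  calc 2 * t / Real.pi = 2 * (2 / Real.pi * (t / 2)) := by ring
    _ ≤ 2 * Real.sin (t / 2) := by gcongr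

lemma rpow_le_one_div_cesaroNumber_neg (h0 : 0 ≤ α) (hα : α < 1) (n : ℕ) :
    ((n : ℝ) + 1) ^ α ≤ 1 / cesaroNumber (-α) n := by
  have hA := cesaroNumber_neg_pos hα n
  rw [le_div_iff₀ hA]
  calc ((n : ℝ) + 1) ^ α * cesaroNumber (-α) n ≤ ((n : ℝ) + 1) ^ α * ((n : ℝ) + 1) ^ (-α) := by
        gcongr
        exact cesaroNumber_neg_le_rpow h0 hα.le n
    _ = 1 := by rw [← Real.rpow_add (by positivity)]; simp

lemma sin_mul_cesaroKernel_ge (h0 : 0 ≤ α) (hα : α < 1) (n : ℕ) {p q t : ℝ} (hp : 0 < p)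
    (hpt : p ≤ t) (htq : t ≤ q) (hq : q ≤ Real.pi) :
    2 * q ^ (α - 1) * ((n : ℝ) + 1) ^ α * Real.sin (kernelPhase α n t) ^ 2
        - Real.pi ^ 2 / ((n + 1) * p ^ 2)
      ≤ Real.sin (kernelPhase α n t) * cesaroKernel (-α) n t := by
  have ht0 : 0 < t := hp.trans_le hpt
  have hkernel := abs_cesaroKernel_sub_le h0 hα n ht0 (htq.trans hq)
  have hSpos : 0 < 2 * Real.sin (t / 2) := mul_pos two_pos (sin_half_pos ht0 (htq.trans hq))
  have hSle : 2 * Real.sin (t / 2) ≤ q := by linarith [Real.sin_le (x := t / 2) (by linarith)]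
  have hSge : 2 * p / Real.pi ≤ 2 * Real.sin (t / 2) :=
    le_trans (by gcongr) (two_mul_div_pi_le_two_mul_sin_half ht0.le (htq.trans hq))
  set S := 2 * Real.sin (t / 2)
  set σ := Real.sin (kernelPhase α n t)
  have hmain : 2 * q ^ (α - 1) * ((n : ℝ) + 1) ^ α * σ ^ 2
      ≤ σ * (2 * S ^ (α - 1) * σ / cesaroNumber (-α) n) := by
    have hpow : q ^ (α - 1) ≤ S ^ (α - 1) :=
      Real.rpow_le_rpow_of_nonpos hSpos hSle (by linarith)
    calc _ ≤ 2 * S ^ (α - 1) * (1 / cesaroNumber (-α) n) * σ ^ 2 := by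
          gcongr
          exact rpow_le_one_div_cesaroNumber_neg h0 hα n
      _ = _ := by ring
  have herror : |σ * (cesaroKernel (-α) n t - 2 * S ^ (α - 1) * σ / cesaroNumber (-α) n)|
      ≤ Real.pi ^ 2 / ((n + 1) * p ^ 2) := by
    rw [abs_mul]
    calc _ ≤ 1 * (4 * 1 / (((n : ℝ) + 1) * (2 * p / Real.pi) ^ 2)) := by
          refine mul_le_mul (Real.abs_sin_le_one _) (hkernel.trans ?_) (abs_nonneg _) one_pos.le
          gcongr
      _ = Real.pi ^ 2 / ((n + 1) * p ^ 2) := by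
          field_simp
          norm_num
  linarith [(abs_le.1 herror).1]

lemma integral_periodicWave_mul (h0 : 0 ≤ α) (hα : α < 1) (hM : 1 ≤ M) (hMn : 2 * M ≤ n)
    (K : ℝ → ℝ) :
    ∫ t in 0..2 * Real.pi, periodicWave α n M t * K t
      = ∫ t in phasePoint α n (M * Real.pi)..phasePoint α n (2 * M * Real.pi),
          Real.sin (kernelPhase α n t) * K t := by
  set p := phasePoint α n (M * Real.pi)
  set q := phasePoint α n (2 * M * Real.pi)
  have hp0 : 0 ≤ p := by
    have := kernelFreq_pos hα n
    exact le_trans (by positivity) (div_kernelFreq_le_phasePoint hα hM)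
  have hpq : p ≤ q := by
    refine (kernelPhase_le_iff hα).1 ?_
    rw [kernelPhase_phasePoint hα]
    nlinarith [Real.pi_pos, M.cast_nonneg (α := ℝ)]
  have hq : q ≤ 2 * Real.pi := by
    linarith [phasePoint_le_div_kernelFreq h0 hα n (2 * M * Real.pi), div_kernelFreq_le_pi hα hMn,
      Real.pi_pos]
  have hsupp : Function.support (fun t => wave α n M t * K t) ⊆ Set.Ioc p q := by
    refine (Function.support_mul_subset_left _ _).trans fun t ht => ⟨?_, ?_⟩ <;> contrapose! ht
    · exact Function.notMem_support.2 (wave_eq_zero_of_le ((kernelPhase_le_iff hα).2 ht))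
    · exact Function.notMem_support.2 (wave_eq_zero_of_ge ((le_kernelPhase_iff hα).2 ht.le))
  calc ∫ t in 0..2 * Real.pi, periodicWave α n M t * K t
      = ∫ t in 0..2 * Real.pi, wave α n M t * K t := by
        refine intervalIntegral.integral_congr fun t ht => ?_
        rw [Set.uIcc_of_le Real.two_pi_pos.le] at ht
        exact congrArg (· * K t) (periodicWave_eq_wave hα.le hM (by omega) ht)
    _ = ∫ t in p..q, wave α n M t * K t := by
        rw [intervalIntegral.integral_eq_integral_of_support_subset hsupp,
          intervalIntegral.integral_eq_integral_of_support_subset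
            (hsupp.trans (Set.Ioc_subset_Ioc hp0 hq))]
    _ = ∫ t in p..q, Real.sin (kernelPhase α n t) * K t := by
        refine intervalIntegral.integral_congr fun t ht => ?_
        rw [Set.uIcc_of_le hpq] at ht
        simp only [wave_eq_sin ((le_kernelPhase_iff hα).2 ht.1) ((kernelPhase_le_iff hα).2 ht.2)]

lemma integral_sin_kernelPhase_sq (hα : α < 1) (n M : ℕ) :
    ∫ t in phasePoint α n (M * Real.pi)..phasePoint α n (2 * M * Real.pi),
      Real.sin (kernelPhase α n t) ^ 2 = M * Real.pi / (2 * kernelFreq α n) := by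
  have hν := kernelFreq_pos hα n
  have hsin : Real.sin (2 * M * Real.pi) = 0 := by exact_mod_cast Real.sin_nat_mul_pi (2 * M)
  have hsubst := intervalIntegral.integral_comp_mul_add
    (a := phasePoint α n (M * Real.pi)) (b := phasePoint α n (2 * M * Real.pi))
    (fun u => Real.sin u ^ 2) hν.ne' (α * Real.pi / 2)
  have hphase : ∀ t, kernelFreq α n * t + α * Real.pi / 2 = kernelPhase α n t := fun _ => rfl
  simp only [hphase, kernelPhase_phasePoint hα] at hsubst
  rw [hsubst, integral_sin_sq, hsin, Real.sin_nat_mul_pi, smul_eq_mul]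
  field_simp
  ring

lemma rpow_div_two_le_mul_rpow (h0 : 0 ≤ α) (hα : α < 1) {ν m q : ℝ} (hν : 0 < ν) (hm : 0 < m)
    (hq0 : 0 < q) (hq : q ≤ 2 * m * Real.pi / ν) :
    m ^ α / 2 ≤ 2 * q ^ (α - 1) * ν ^ α * (m * Real.pi / (2 * ν)) := by
  have hpi : 1 ≤ (2 * Real.pi) ^ α := Real.one_le_rpow (by linarith [Real.pi_gt_three]) h0
  have hpow : (2 * m * Real.pi / ν) ^ (α - 1)
      = (2 * Real.pi) ^ α * m ^ α / ν ^ α / (2 * m * Real.pi / ν) := by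
    rw [Real.rpow_sub_one (by positivity), Real.div_rpow (by positivity) hν.le,
      mul_right_comm, Real.mul_rpow (by positivity) hm.le]
  calc m ^ α / 2 ≤ (2 * Real.pi) ^ α * m ^ α / 2 := by
        gcongr
        exact le_mul_of_one_le_left (by positivity) hpi
    _ = 2 * (2 * m * Real.pi / ν) ^ (α - 1) * ν ^ α * (m * Real.pi / (2 * ν)) := by
        rw [hpow]
        have : 0 < ν ^ α := by positivity
        field_simp
    _ ≤ 2 * q ^ (α - 1) * ν ^ α * (m * Real.pi / (2 * ν)) := by
        gcongr 2 * ?_ * _ * _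
        exact Real.rpow_le_rpow_of_nonpos hq0 hq (by linarith)

lemma mul_pi_div_mul_pi_sq_div_le {ν m p x : ℝ} (hν : 0 < ν) (hm : 64 ≤ m) (hx : ν ≤ x)
    (hp : m * Real.pi / (2 * ν) ≤ p) :
    m * Real.pi / ν * (Real.pi ^ 2 / (x * p ^ 2)) ≤ 1 / 4 := by
  have hx0 := hν.trans_le hx
  calc _ ≤ m * Real.pi / ν * (Real.pi ^ 2 / (ν * (m * Real.pi / (2 * ν)) ^ 2)) := by gcongr
    _ = 4 * Real.pi / m := by field_simp; norm_num
    _ ≤ 4 * 4 / 64 := by gcongr; exact Real.pi_le_four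
    _ = 1 / 4 := by norm_num

lemma integral_periodicWave_mul_cesaroKernel_ge (h0 : 0 ≤ α) (hα : α < 1) (hM : 64 ≤ M)
    (hMn : 2 * M ≤ n) :
    (M : ℝ) ^ α / 4 ≤ ∫ t in 0..2 * Real.pi, periodicWave α n M t * cesaroKernel (-α) n t := by
  have hM64 : (64 : ℝ) ≤ M := by exact_mod_cast hM
  have hν := kernelFreq_pos hα n
  have hνn : kernelFreq α n ≤ n + 1 := by unfold kernelFreq; linarith
  have hp := div_kernelFreq_le_phasePoint hα (M := M) (n := n) (by omega)
  have hq := phasePoint_le_div_kernelFreq h0 hα n (2 * M * Real.pi)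
  have hsin := integral_sin_kernelPhase_sq hα n M
  have hlength : phasePoint α n (2 * M * Real.pi) - phasePoint α n (M * Real.pi)
      = M * Real.pi / kernelFreq α n := by
    unfold phasePoint; ring
  rw [integral_periodicWave_mul h0 hα (by omega) hMn]
  set ν := kernelFreq α n
  set p := phasePoint α n (M * Real.pi)
  set q := phasePoint α n (2 * M * Real.pi)
  have hp0 : 0 < p := lt_of_lt_of_le (by positivity) hp
  have hpq : p ≤ q := sub_nonneg.1 (hlength ▸ by positivity)
  calc (M : ℝ) ^ α / 4 ≤ (M : ℝ) ^ α / 2 - 1 / 4 := by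
        linarith [Real.one_le_rpow (show (1 : ℝ) ≤ M by linarith) h0]
    _ ≤ 2 * q ^ (α - 1) * ν ^ α * (M * Real.pi / (2 * ν)) - 1 / 4 := by
        gcongr
        exact rpow_div_two_le_mul_rpow h0 hα hν (by positivity) (by linarith) hq
    _ ≤ 2 * q ^ (α - 1) * ((n : ℝ) + 1) ^ α * (M * Real.pi / (2 * ν))
          - M * Real.pi / ν * (Real.pi ^ 2 / ((n + 1) * p ^ 2)) := by
        have : 0 < q := by linarith
        gcongr
        exact mul_pi_div_mul_pi_sq_div_le hν hM64 hνn hp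
    _ = ∫ t in p..q, (2 * q ^ (α - 1) * ((n : ℝ) + 1) ^ α * Real.sin (kernelPhase α n t) ^ 2
          - Real.pi ^ 2 / ((n + 1) * p ^ 2)) := by
        rw [intervalIntegral.integral_sub (Continuous.intervalIntegrable (by fun_prop) _ _)
          (Continuous.intervalIntegrable (by fun_prop) _ _), intervalIntegral.integral_const_mul,
          hsin, intervalIntegral.integral_const, hlength, smul_eq_mul]
    _ ≤ ∫ t in p..q, Real.sin (kernelPhase α n t) * cesaroKernel (-α) n t :=
        intervalIntegral.integral_mono_on hpq (Continuous.intervalIntegrable (by fun_prop) _ _)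
          (Continuous.intervalIntegrable (by fun_prop) _ _) fun t ht =>
          sin_mul_cesaroKernel_ge h0 hα n hp0 ht.1 ht.2 (hq.trans (div_kernelFreq_le_pi hα hMn))

end Resonance

/-! ### Blocks of dyadic waves -/

/-- The sum of the tensor products of dyadic waves, with weights `λ_{2^k} / 2^k`: the block of the
final function that resonates with the kernels of index `2^n`. Waves of `2^6 = 64` half-periods are
the shortest for which the error of the kernel asymptotics contributes at most `1 / 4`. -/
def blockSum (lam : ℕ → ℝ) (α β : ℝ) (n : ℕ) (x y : ℝ) : ℝ :=
  ∑ k ∈ Finset.Ico 6 n, lam (2 ^ k) / (2 ^ k : ℕ) *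
    (periodicWave α (2 ^ n) (2 ^ k) x * periodicWave β (2 ^ n) (2 ^ k) y)

lemma periodicWave_eq_zero_or (α : ℝ) (n : ℕ) {M M' : ℕ} (h : 2 * M ≤ M') (t : ℝ) :
    periodicWave α n M t = 0 ∨ periodicWave α n M' t = 0 := by
  rcases le_total (kernelPhase α n (2 * Real.pi * Int.fract (t / (2 * Real.pi))))
    (M' * Real.pi) with hle | hge
  · exact Or.inr (wave_eq_zero_of_le hle)
  · have h' : 2 * (M : ℝ) ≤ M' := by exact_mod_cast h
    exact Or.inl (wave_eq_zero_of_ge (hge.trans' (by gcongr)))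

lemma subsingleton_setOf_periodicWave_ne_zero (α : ℝ) (n : ℕ) (t : ℝ) :
    {k : ℕ | periodicWave α n (2 ^ k) t ≠ 0}.Subsingleton := by
  have hdisj : ∀ {k l : ℕ}, k < l →
      periodicWave α n (2 ^ k) t = 0 ∨ periodicWave α n (2 ^ l) t = 0 := fun {k l} hkl =>
    periodicWave_eq_zero_or α n (pow_succ' 2 k ▸ Nat.pow_le_pow_right two_pos hkl) t
  intro k hk l hl
  by_contra hne
  rcases lt_or_gt_of_ne hne with hlt | hlt
  · exact (hdisj hlt).elim hk hl
  · exact (hdisj hlt).elim hl hk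

section BlockSum

variable (lam : ℕ → ℝ) (α β : ℝ) (n : ℕ)

lemma blockSum_swap (x y : ℝ) : blockSum lam α β n x y = blockSum lam β α n y x := by
  simp only [blockSum, mul_comm (periodicWave α _ _ x)]

lemma blockSum_periodic_left (y : ℝ) :
    Function.Periodic (fun x => blockSum lam α β n x y) (2 * Real.pi) := fun x => by
  simp only [blockSum, periodicWave, periodize_periodic _ x]

lemma blockSum_periodic_right (x : ℝ) : Function.Periodic (blockSum lam α β n x) (2 * Real.pi) :=
  fun y => by simp only [blockSum_swap lam α β n x, blockSum_periodic_left lam β α n x y]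

lemma exists_blockSum_eq_mul (y : ℝ) :
    ∃ k ≤ n, ∃ d : ℝ, |d| ≤ 1 ∧ ∀ x, blockSum lam α β n x y
      = d * (lam (2 ^ k) / (2 ^ k : ℕ)) * periodicWave α (2 ^ n) (2 ^ k) x := by
  by_cases h : ∃ k ∈ Finset.Ico 6 n, periodicWave β (2 ^ n) (2 ^ k) y ≠ 0
  · obtain ⟨k, hkn, hk⟩ := h
    refine ⟨k, (Finset.mem_Ico.1 hkn).2.le, periodicWave β (2 ^ n) (2 ^ k) y,
      abs_periodicWave_le_one _ _ _ _, fun x => ?_⟩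
    rw [blockSum, Finset.sum_eq_single_of_mem k hkn fun l _ hl => ?_]
    · ring
    · have hl0 : periodicWave β (2 ^ n) (2 ^ l) y = 0 := by
        by_contra h0
        exact hl (subsingleton_setOf_periodicWave_ne_zero β (2 ^ n) y h0 hk)
      simp only [hl0, mul_zero]
  · push Not at h
    refine ⟨0, n.zero_le, 0, by simp, fun x => ?_⟩
    rw [zero_mul, zero_mul]
    exact Finset.sum_eq_zero fun k hk => by simp only [h k hk, mul_zero]

variable {α β}

lemma continuous_periodicWave_two_pow (hα : α ≤ 1) {k n : ℕ} (hk : k ≤ n) :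
    Continuous (periodicWave α (2 ^ n) (2 ^ k)) :=
  continuous_periodicWave hα Nat.one_le_two_pow (Nat.pow_le_pow_right two_pos hk)

lemma continuous_blockSum (hα : α ≤ 1) (hβ : β ≤ 1) :
    Continuous fun p : ℝ × ℝ => blockSum lam α β n p.1 p.2 := by
  refine continuous_finsetSum _ fun k hk => ?_
  have hkn := (Finset.mem_Ico.1 hk).2.le
  have hu := continuous_periodicWave_two_pow hα hkn
  have hv := continuous_periodicWave_two_pow hβ hkn
  fun_prop

variable {lam} {s : ℝ}

lemma weightedSum_blockSum_le (hs0 : 0 < s) (hs1 : s ≤ 1) (hpos : ∀ k, 1 ≤ k → 0 < lam k)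
    (hmono : MonotoneOn lam (Set.Ici 1))
    (hanti : AntitoneOn (fun k : ℕ => lam k / (k : ℝ) ^ (1 - s)) (Set.Ici 1)) (hα : α ≤ 1)
    (β : ℝ) (y : ℝ) (E : IntervalFamily) :
    E.weightedSum lam (fun x => blockSum lam α β n x y) ≤ 2 / s + Real.pi := by
  obtain ⟨k, hk, d, hd, hblock⟩ := exists_blockSum_eq_mul lam α β n y
  have hc : 0 < lam (2 ^ k) / (2 ^ k : ℕ) := div_pos (hpos _ Nat.one_le_two_pow) (by positivity)
  simp only [hblock]
  rw [E.weightedSum_const_mul, abs_mul, abs_of_pos hc, mul_assoc]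
  exact (mul_le_of_le_one_left (mul_nonneg hc.le (E.weightedSum_nonneg hpos _)) hd).trans
    (weightedSum_periodicWave_le hα Nat.one_le_two_pow (Nat.pow_le_pow_right two_pos hk) hs0 hs1
      hpos hmono hanti E)

lemma div_le_of_antitoneOn (hs0 : 0 ≤ s) (hpos : ∀ k, 1 ≤ k → 0 < lam k)
    (hanti : AntitoneOn (fun k : ℕ => lam k / (k : ℝ) ^ (1 - s)) (Set.Ici 1)) {M : ℕ}
    (hM : 1 ≤ M) : lam M / M ≤ lam 1 := by
  have hMp := hpos M hM
  have hM' : (1 : ℝ) ≤ M := by exact_mod_cast hM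
  calc lam M / M = lam M / (M : ℝ) ^ (1 : ℝ) := by rw [Real.rpow_one]
    _ ≤ lam M / (M : ℝ) ^ (1 - s) := by gcongr; linarith
    _ ≤ lam 1 / ((1 : ℕ) : ℝ) ^ (1 - s) := hanti Set.self_mem_Ici hM hM
    _ = lam 1 := by simp

lemma abs_blockSum_le (hs0 : 0 ≤ s) (hpos : ∀ k, 1 ≤ k → 0 < lam k)
    (hanti : AntitoneOn (fun k : ℕ => lam k / (k : ℝ) ^ (1 - s)) (Set.Ici 1)) (α β x y : ℝ) :
    |blockSum lam α β n x y| ≤ lam 1 := by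
  obtain ⟨k, -, d, hd, hblock⟩ := exists_blockSum_eq_mul lam α β n y
  have hc : 0 < lam (2 ^ k) / (2 ^ k : ℕ) := div_pos (hpos _ Nat.one_le_two_pow) (by positivity)
  have hcle := div_le_of_antitoneOn hs0 hpos hanti (M := 2 ^ k) Nat.one_le_two_pow
  have hlam := hpos 1 le_rfl
  rw [hblock, abs_mul, abs_mul, abs_of_pos hc]
  calc _ ≤ 1 * lam 1 * 1 := by
        gcongr
        exact abs_periodicWave_le_one _ _ _ _
    _ = lam 1 := by ring

end BlockSum

lemma mul_integral_mul_integral_ge {α β c : ℝ} (hα : α ∈ Set.Ico 0 1) (hβ : β ∈ Set.Ico 0 1)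
    (hc : 0 ≤ c) {n M : ℕ} (hM : 64 ≤ M) (hMn : 2 * M ≤ n) :
    M * (c / (M : ℝ) ^ (2 - (α + β))) / 16
      ≤ c / M * ((∫ t in 0..2 * Real.pi, periodicWave α n M t * cesaroKernel (-α) n t)
          * ∫ t in 0..2 * Real.pi, periodicWave β n M t * cesaroKernel (-β) n t) := by
  have hM0 : (0 : ℝ) < M := by
    have : 0 < M := by omega
    exact_mod_cast this
  have hpow : (M : ℝ) ^ (2 - (α + β)) = M ^ 2 / ((M : ℝ) ^ α * (M : ℝ) ^ β) := by
    rw [Real.rpow_sub hM0, Real.rpow_add hM0, Real.rpow_two]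
  have hI := integral_periodicWave_mul_cesaroKernel_ge hα.1 hα.2 hM hMn
  have hJ := integral_periodicWave_mul_cesaroKernel_ge hβ.1 hβ.2 hM hMn
  calc M * (c / (M : ℝ) ^ (2 - (α + β))) / 16
      = c / M * ((M : ℝ) ^ α / 4 * ((M : ℝ) ^ β / 4)) := by
        rw [hpow]
        field_simp
        norm_num
    _ ≤ _ := by
        have := hI.trans' (by positivity : 0 ≤ (M : ℝ) ^ α / 4)
        gcongr

lemma integral_blockSum_mul_cesaroKernel_ge {lam : ℕ → ℝ} (hpos : ∀ k, 1 ≤ k → 0 < lam k) {α β : ℝ}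
    (hα : α ∈ Set.Ico 0 1) (hβ : β ∈ Set.Ico 0 1) (n : ℕ) :
    (∑ k ∈ Finset.Ico 6 n, (2 ^ k : ℕ) * (lam (2 ^ k) / ((2 ^ k : ℕ) : ℝ) ^ (2 - (α + β)))) / 16
      ≤ ∫ p in periodSquare, blockSum lam α β n p.1 p.2 *
          (cesaroKernel (-α) (2 ^ n) p.1 * cesaroKernel (-β) (2 ^ n) p.2) := by
  have hterm : ∀ k (p : ℝ × ℝ), lam (2 ^ k) / (2 ^ k : ℕ) *
      (periodicWave α (2 ^ n) (2 ^ k) p.1 * periodicWave β (2 ^ n) (2 ^ k) p.2) *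
      (cesaroKernel (-α) (2 ^ n) p.1 * cesaroKernel (-β) (2 ^ n) p.2)
      = lam (2 ^ k) / (2 ^ k : ℕ) *
        ((periodicWave α (2 ^ n) (2 ^ k) p.1 * cesaroKernel (-α) (2 ^ n) p.1) *
          (periodicWave β (2 ^ n) (2 ^ k) p.2 * cesaroKernel (-β) (2 ^ n) p.2)) := fun k p => by
    ring
  simp only [blockSum, Finset.sum_mul, hterm]
  rw [integral_finsetSum _ fun k hk => ?integrable, Finset.sum_div]
  case integrable =>
    have hkn := (Finset.mem_Ico.1 hk).2.le
    have hu := continuous_periodicWave_two_pow hα.2.le hkn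
    have hv := continuous_periodicWave_two_pow hβ.2.le hkn
    exact integrableOn_periodSquare (by fun_prop)
  refine Finset.sum_le_sum fun k hk => ?_
  obtain ⟨hk6, hkn⟩ := Finset.mem_Ico.1 hk
  rw [integral_const_mul, integral_periodSquare_mul
    (fun x => periodicWave α (2 ^ n) (2 ^ k) x * cesaroKernel (-α) (2 ^ n) x)
    fun y => periodicWave β (2 ^ n) (2 ^ k) y * cesaroKernel (-β) (2 ^ n) y]
  exact mul_integral_mul_integral_ge hα hβ (hpos _ Nat.one_le_two_pow).le
    (Nat.pow_le_pow_right two_pos hk6 : 2 ^ 6 ≤ 2 ^ k)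
    (pow_succ' 2 k ▸ Nat.pow_le_pow_right two_pos hkn)

lemma tendsto_sum_Ico_condensed_atTop {a : ℕ → ℝ} (ha : AntitoneOn a (Set.Ici 1))
    (hdiv : Tendsto (fun n => ∑ k ∈ Finset.Icc 1 n, a k) atTop atTop) (m : ℕ) :
    Tendsto (fun n => ∑ k ∈ Finset.Ico m n, (2 ^ k : ℕ) * a (2 ^ k)) atTop atTop := by
  have hpow : Tendsto (fun n : ℕ => 2 ^ n - 1) atTop atTop :=
    tendsto_atTop_mono (fun n => Nat.le_sub_one_of_lt n.lt_two_pow_self) tendsto_id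
  have hcond : ∀ n, ∑ k ∈ Finset.Icc 1 (2 ^ n - 1), a k
      ≤ ∑ k ∈ Finset.range n, (2 ^ k : ℕ) * a (2 ^ k) := fun n => by
    have hIcc : Finset.Icc 1 (2 ^ n - 1) = Finset.Ico 1 (2 ^ n) := by
      ext k
      have := Nat.two_pow_pos n
      simp only [Finset.mem_Icc, Finset.mem_Ico]
      omega
    simpa only [hIcc, nsmul_eq_mul] using
      Finset.le_sum_condensed' (fun _ _ hk hkl => ha hk (hk.trans_le hkl) hkl) n
  have hrange := tendsto_atTop_mono hcond (hdiv.comp hpow)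
  refine (tendsto_atTop_add_const_right _ (-∑ k ∈ Finset.range m, (2 ^ k : ℕ) * a (2 ^ k))
    hrange).congr' ?_
  filter_upwards [eventually_ge_atTop m] with n hn
  rw [← Finset.sum_range_add_sum_Ico _ hn, add_neg_cancel_comm]

lemma antitoneOn_div_rpow_two_sub {lam : ℕ → ℝ} {s : ℝ} (hpos : ∀ k, 1 ≤ k → 0 < lam k)
    (hanti : AntitoneOn (fun k : ℕ => lam k / (k : ℝ) ^ (1 - s)) (Set.Ici 1)) :
    AntitoneOn (fun k : ℕ => lam k / (k : ℝ) ^ (2 - s)) (Set.Ici 1) := by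
  have hsplit : ∀ k : ℕ, 1 ≤ k → lam k / (k : ℝ) ^ (2 - s) = lam k / (k : ℝ) ^ (1 - s) / k := by
    intro k hk
    have hk' : (k : ℝ) ≠ 0 := by positivity
    rw [div_div, ← Real.rpow_add_one hk']
    ring_nf
  intro k (hk : 1 ≤ k) l (hl : 1 ≤ l) hkl
  have hlam := hpos k hk
  have hk' : (0 : ℝ) < k := by exact_mod_cast hk
  simp only [hsplit k hk, hsplit l hl]
  exact div_le_div₀ (by positivity) (hanti hk hl hkl) hk' (by exact_mod_cast hkl)

lemma exists_lt_integral_blockSum_mul_cesaroKernel {lam : ℕ → ℝ} (hpos : ∀ k, 1 ≤ k → 0 < lam k)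
    {α β : ℝ} (hα : α ∈ Set.Ico 0 1) (hβ : β ∈ Set.Ico 0 1)
    (hanti : AntitoneOn (fun k : ℕ => lam k / (k : ℝ) ^ (1 - (α + β))) (Set.Ici 1))
    (hdiv : Tendsto (fun n : ℕ => ∑ k ∈ Finset.Icc 1 n, lam k / (k : ℝ) ^ (2 - (α + β)))
      atTop atTop) (C : ℝ) :
    ∃ n, C < ∫ p in periodSquare, blockSum lam α β n p.1 p.2 *
      (cesaroKernel (-α) (2 ^ n) p.1 * cesaroKernel (-β) (2 ^ n) p.2) := by
  obtain ⟨n, hn⟩ := ((tendsto_sum_Ico_condensed_atTop (antitoneOn_div_rpow_two_sub hpos hanti)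
    hdiv 6).eventually_gt_atTop (16 * C)).exists
  exact ⟨n, lt_of_lt_of_le ((lt_div_iff₀' (by norm_num)).2 hn)
    (integral_blockSum_mul_cesaroKernel_ge hpos hα hβ n)⟩

/-! ### Condensation of singularities -/

section Superposition

variable {𝕜 E F ι : Type*} [NontriviallyNormedField 𝕜] [NormedAddCommGroup E]
  [NormedSpace 𝕜 E] [SeminormedAddCommGroup F] [NormedSpace 𝕜 F]

lemma norm_smul_le_of_norm_le {v : ι → E} {B : ℝ} (hv : ∀ i, ‖v i‖ ≤ B) (c : ι → 𝕜) (i : ι) :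
    ‖c i • v i‖ ≤ ‖c i‖ * B :=
  (norm_smul_le _ _).trans (by gcongr; exact hv i)

variable [CompleteSpace E]

lemma summable_smul_of_norm_le {v : ι → E} {B : ℝ} (hv : ∀ i, ‖v i‖ ≤ B) {c : ι → 𝕜}
    (hc : Summable fun i => ‖c i‖) : Summable fun i => c i • v i :=
  .of_norm_bounded (hc.mul_right B) (norm_smul_le_of_norm_le hv c)

lemma hasSum_norm_lp_one (c : lp (fun _ : ι => 𝕜) 1) : HasSum (fun i => ‖c i‖) ‖c‖ := by
  simpa using lp.hasSum_norm (p := 1) (by simp) c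

/-- The operator `c ↦ ∑ᵢ cᵢ vᵢ` from `ℓ¹` to a Banach space, for a bounded family `v`. -/
def superposition (v : ι → E) {B : ℝ} (hv : ∀ i, ‖v i‖ ≤ B) : lp (fun _ : ι => 𝕜) 1 →L[𝕜] E :=
  LinearMap.mkContinuous
    { toFun := fun c => ∑' i, c i • v i
      map_add' := fun c d => by
        simp only [lp.coeFn_add, Pi.add_apply, add_smul]
        exact (summable_smul_of_norm_le hv (hasSum_norm_lp_one c).summable).tsum_add
          (summable_smul_of_norm_le hv (hasSum_norm_lp_one d).summable)
      map_smul' := fun r c => by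
        simp only [lp.coeFn_smul, Pi.smul_apply, smul_assoc, RingHom.id_apply]
        exact (summable_smul_of_norm_le hv (hasSum_norm_lp_one c).summable).tsum_const_smul r } B
    fun c => by
      rw [mul_comm]
      exact tsum_of_norm_bounded ((hasSum_norm_lp_one c).mul_right B)
        (norm_smul_le_of_norm_le hv c)

lemma superposition_apply {v : ι → E} {B : ℝ} (hv : ∀ i, ‖v i‖ ≤ B)
    (c : lp (fun _ : ι => 𝕜) 1) : superposition v hv c = ∑' i, c i • v i :=
  rfl

lemma superposition_single [DecidableEq ι] {v : ι → E} {B : ℝ} (hv : ∀ i, ‖v i‖ ≤ B) (i : ι) :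
    superposition (𝕜 := 𝕜) v hv (lp.single 1 i 1) = v i := by
  rw [superposition_apply, tsum_eq_single i fun j hj => by simp [lp.single_apply, hj]]
  simp [lp.single_apply]

lemma exists_summable_norm_unbounded [CompleteSpace 𝕜] {v : ι → E} {B : ℝ} (hv : ∀ i, ‖v i‖ ≤ B)
    (L : ι → E →L[𝕜] F) (hL : ∀ C, ∃ i, C < ‖L i (v i)‖) :
    ∃ c : ι → 𝕜, Summable (fun i => ‖c i‖) ∧ ¬ ∃ C, ∀ i, ‖L i (∑' j, c j • v j)‖ ≤ C := by
  classical
  by_contra! hbounded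
  obtain ⟨C, hC⟩ := banach_steinhaus (g := fun i => (L i).comp (superposition v hv)) fun c =>
    hbounded c (hasSum_norm_lp_one c).summable
  obtain ⟨i, hi⟩ := hL C
  have hle := ((L i).comp (superposition v hv)).le_of_opNorm_le (hC i) (lp.single 1 i 1)
  rw [ContinuousLinearMap.comp_apply, superposition_single, lp.norm_single (by simp), norm_one,
    mul_one] at hle
  exact hi.not_ge hle

end Superposition

lemma norm_cesaroMean_zero (a b : ℝ) (n m : ℕ) (F : (ℝ × ℝ) →ᵇ ℝ) :
    ‖cesaroMean a b (fun x y => F (x, y)) n m 0 0‖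
      = ‖kernelFunctional a b n m F‖ / (4 * Real.pi ^ 2) := by
  rw [cesaroMean_zero a b (f := fun x y => F (x, y)) F.continuous, ← kernelFunctional_apply,
    Complex.norm_real, norm_mul, Real.norm_of_nonneg (r := 1 / (4 * Real.pi ^ 2)) (by positivity),
    one_div_mul_eq_div]

lemma exists_hasSum_cesaroMean_unbounded (a b : ℝ) {f : ℕ → ℝ → ℝ → ℝ} {B : ℝ}
    (hf : ∀ j, Continuous fun p : ℝ × ℝ => f j p.1 p.2) (hB : ∀ j x y, |f j x y| ≤ B) (N : ℕ → ℕ)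
    (hunb : ∀ C, ∃ j, C < ∫ p in periodSquare, f j p.1 p.2 *
      (cesaroKernel a (N j) p.1 * cesaroKernel b (N j) p.2)) :
    ∃ (c : ℕ → ℝ) (F : ℝ → ℝ → ℝ), Summable (fun j => |c j|) ∧
      (∀ x y, HasSum (fun j => c j * f j x y) (F x y)) ∧ (Continuous fun p : ℝ × ℝ => F p.1 p.2) ∧
      ¬ ∃ C, ∀ n, ‖cesaroMean a b F n n 0 0‖ ≤ C := by
  let v : ℕ → (ℝ × ℝ) →ᵇ ℝ := fun j =>
    .ofNormedAddCommGroup (fun p => f j p.1 p.2) (hf j) B fun p => hB j p.1 p.2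
  have hv : ∀ j, ‖v j‖ ≤ B := fun j =>
    BoundedContinuousFunction.norm_ofNormedAddCommGroup_le _ ((abs_nonneg _).trans (hB j 0 0)) _
  obtain ⟨c, hc, hcunb⟩ := exists_summable_norm_unbounded hv
    (fun j => kernelFunctional a b (N j) (N j)) fun C =>
      (hunb C).imp fun j hj => hj.trans_le (Real.le_norm_self _)
  set F := ∑' j, c j • v j
  have hsum : ∀ p, HasSum (fun j => c j * v j p) (F p) := fun p =>
    (BoundedContinuousFunction.evalCLM ℝ p).hasSum (summable_smul_of_norm_le hv hc).hasSum
  refine ⟨c, fun x y => F (x, y), hc, fun x y => hsum (x, y), F.continuous, ?_⟩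
  rintro ⟨C, hC⟩
  refine hcunb ⟨C * (4 * Real.pi ^ 2), fun j => ?_⟩
  have hj := hC (N j)
  rwa [norm_cesaroMean_zero, div_le_iff₀ (by positivity)] at hj

lemma isPLambdaBV_of_weightedSum_le {lam : ℕ → ℝ} {F : ℝ → ℝ → ℝ} {V : ℝ}
    (hper₁ : ∀ y, Function.Periodic (fun x => F x y) (2 * Real.pi))
    (hper₂ : ∀ x, Function.Periodic (F x) (2 * Real.pi))
    (hV₁ : ∀ y (E : IntervalFamily), E.weightedSum lam (fun x => F x y) ≤ V)
    (hV₂ : ∀ x (E : IntervalFamily), E.weightedSum lam (F x) ≤ V) : IsPLambdaBV lam F where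
  periodic₁ x y := hper₁ y x
  periodic₂ x y := hper₂ x y
  variation_lt_top := ENNReal.add_lt_top.2
    ⟨(iSup₂_le fun y _ => iSup_le fun E => ENNReal.ofReal_le_ofReal (hV₁ y E)).trans_lt
        ENNReal.ofReal_lt_top,
      (iSup₂_le fun x _ => iSup_le fun E => ENNReal.ofReal_le_ofReal (hV₂ x E)).trans_lt
        ENNReal.ofReal_lt_top⟩

lemma isPLambdaBV_of_hasSum {lam : ℕ → ℝ} (hpos : ∀ k, 1 ≤ k → 0 < lam k) {ι : Type*} {c : ι → ℝ}
    (hc : Summable fun j => |c j|) {f : ι → ℝ → ℝ → ℝ} {F : ℝ → ℝ → ℝ} {V : ℝ} (hV : 0 ≤ V)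
    (hF : ∀ x y, HasSum (fun j => c j * f j x y) (F x y))
    (hper₁ : ∀ j y, Function.Periodic (fun x => f j x y) (2 * Real.pi))
    (hper₂ : ∀ j x, Function.Periodic (f j x) (2 * Real.pi))
    (hV₁ : ∀ j y (E : IntervalFamily), E.weightedSum lam (fun x => f j x y) ≤ V)
    (hV₂ : ∀ j x (E : IntervalFamily), E.weightedSum lam (f j x) ≤ V) : IsPLambdaBV lam F := by
  refine isPLambdaBV_of_weightedSum_le (fun y x => ?_) (fun x y => ?_)
    (fun y E => E.weightedSum_le_of_hasSum hpos hc hV (fun x => hF x y) fun j => hV₁ j y E)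
    fun x E => E.weightedSum_le_of_hasSum hpos hc hV (hF x) fun j => hV₂ j x E
  · exact (hF _ _).unique ((hF x y).congr_fun fun j => congrArg _ (hper₁ j y x))
  · exact (hF _ _).unique ((hF x y).congr_fun fun j => congrArg _ (hper₂ j x y))

end DoubleFourier

end

theorem theorem2_general (α β : ℝ) (hα : α ∈ Set.Ico (0 : ℝ) 1) (hβ : β ∈ Set.Ico (0 : ℝ) 1)
    (hαβ₀ : 0 < α + β) (hαβ : α + β ≤ 1) (lam : ℕ → ℝ)
    (hpos : ∀ k : ℕ, 1 ≤ k → 0 < lam k)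
    (hmono : ∀ k : ℕ, 1 ≤ k → lam k ≤ lam (k + 1))
    (hanti : ∀ k : ℕ, 1 ≤ k →
      lam (k + 1) / ((k + 1 : ℕ) : ℝ) ^ (1 - (α + β)) ≤ lam k / (k : ℝ) ^ (1 - (α + β)))
    (hdiv : Filter.Tendsto
      (fun n : ℕ => ∑ k ∈ Finset.Icc 1 n, lam k / (k : ℝ) ^ (2 - (α + β)))
      Filter.atTop Filter.atTop) :
    ∃ f : ℝ → ℝ → ℝ, Continuous (fun p : ℝ × ℝ => f p.1 p.2) ∧
      DoubleFourier.IsPLambdaBV lam f ∧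
      (¬ ∃ C : ℝ, ∀ N : ℕ, ‖DoubleFourier.cesaroMean (-α) (-β) f N N 0 0‖ ≤ C) ∧
      (¬ ∃ L : ℂ, Filter.Tendsto
        (fun N : ℕ => DoubleFourier.cesaroMean (-α) (-β) f N N 0 0)
        Filter.atTop (nhds L)) := by
  open DoubleFourier in
  have hmono' : MonotoneOn lam (Set.Ici 1) := monotoneOn_nat_Ici_of_le_succ hmono
  have hanti' : AntitoneOn (fun k : ℕ => lam k / (k : ℝ) ^ (1 - (α + β))) (Set.Ici 1) :=
    antitoneOn_nat_Ici_of_succ_le hanti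
  obtain ⟨c, f, hc, hsum, hcont, hunb⟩ := exists_hasSum_cesaroMean_unbounded (-α) (-β)
    (fun n => continuous_blockSum lam n hα.2.le hβ.2.le)
    (fun n => abs_blockSum_le n hαβ₀.le hpos hanti' α β) (2 ^ ·)
    (exists_lt_integral_blockSum_mul_cesaroKernel hpos hα hβ hanti' hdiv)
  have hvar₁ := fun n => weightedSum_blockSum_le n hαβ₀ hαβ hpos hmono' hanti' hα.2.le β
  have hvar₂ : ∀ n x (E : IntervalFamily), E.weightedSum lam (blockSum lam α β n x)
      ≤ 2 / (α + β) + Real.pi := fun n x E => by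
    simpa only [← blockSum_swap] using
      weightedSum_blockSum_le n hαβ₀ hαβ hpos hmono' hanti' hβ.2.le α x E
  refine ⟨f, hcont, isPLambdaBV_of_hasSum hpos hc (by positivity) hsum
    (blockSum_periodic_left lam α β) (blockSum_periodic_right lam α β) hvar₁ hvar₂, hunb, ?_⟩
  rintro ⟨L, hL⟩
  obtain ⟨C, hC⟩ := (Metric.isBounded_range_of_tendsto _ hL).exists_norm_le
  exact hunb ⟨C, fun N => hC _ ⟨N, rfl⟩⟩

theorem theorem2 (α β : ℝ) (hα : α ∈ Set.Ioo (0 : ℝ) 1) (hβ : β ∈ Set.Ioo (0 : ℝ) 1)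
    (hαβ : α + β < 1) (lam : ℕ → ℝ)
    (hpos : ∀ k : ℕ, 1 ≤ k → 0 < lam k)
    (hmono : ∀ k : ℕ, 1 ≤ k → lam k ≤ lam (k + 1))
    (hanti : ∀ k : ℕ, 1 ≤ k →
      lam (k + 1) / ((k + 1 : ℕ) : ℝ) ^ (1 - (α + β)) ≤ lam k / (k : ℝ) ^ (1 - (α + β)))
    (hzero : Filter.Tendsto (fun k : ℕ => lam k / (k : ℝ) ^ (1 - (α + β)))
      Filter.atTop (nhds 0))
    (hdiv : Filter.Tendsto
      (fun n : ℕ => ∑ k ∈ Finset.Icc 1 n, lam k / (k : ℝ) ^ (2 - (α + β)))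
      Filter.atTop Filter.atTop) :
    ∃ f : ℝ → ℝ → ℝ, Continuous (fun p : ℝ × ℝ => f p.1 p.2) ∧
      DoubleFourier.IsPLambdaBV lam f ∧
      (¬ ∃ C : ℝ, ∀ N : ℕ, ‖DoubleFourier.cesaroMean (-α) (-β) f N N 0 0‖ ≤ C) ∧
      (¬ ∃ L : ℂ, Filter.Tendsto
        (fun N : ℕ => DoubleFourier.cesaroMean (-α) (-β) f N N 0 0)
        Filter.atTop (nhds L)) :=
  theorem2_general α β (Set.Ioo_subset_Ico_self hα) (Set.Ioo_subset_Ico_self hβ)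
    (add_pos hα.1 hβ.1) hαβ.le lam hpos hmono hanti hdiv
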